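/- For $R>0$ let $D_0(R,R)=\{(x,y)\in\mathbb{C}^2:|x|<R,\ |y|<R\}$, and let $\mathbb{C}\{x,y\}$ be the ring of complex power series in $x,y$ that converge in some neighbourhood of the origin. Let $R_0>0$, $X=D_0(R_0,R_0)$, $\pi(x,y)=xy$, and for $t\in\mathbb{C}$ let $X_t=\{(x,y)\in X: xy=t\}$. Let $dV_t$ be the volume form of the metric induced on the smooth locus of $X_t$ by the Euclidean metric $dx\otimes d\bar x+dy\otimes d\bar y$ of $\mathbb{C}^2$. Let $F$ be a holomorphic function on $X$ whose power series at the origin is an irreducible element of $\mathbb{C}\{x,y\}$, and let $f_t=F|_{X_t}$. Let $$c_0(f_0)=\sup\Big\{c\ge 0:\ \int_{U\cap X_0}|f_0|^{-2c}\,dV_0<\infty\ \text{ for some open neighbourhood } U \text{ of } (0,0)\Big\}$$ be the complex singularity exponent of $f_0$ at the origin (integrals take values in $[0,\infty]$, and $0^{-2c}=\infty$ for $c>0$). Then for every real $c$ with $0<c<c_0(f_0)$ there is $R$ with $0<R\le R_0$ such that, with $U=D_0(R,R)$ and $U_t=X_t\cap U$, the integral $\int_{U_0}|f_0|^{-2c}\,dV_0$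 is finite and $$\lim_{t\to 0}\int_{U_t}\frac{dV_t}{|f_t|^{2c}}=\int_{U_0}\frac{dV_0}{|f_0|^{2c}} .$$ -/

import Mathlib

open Set Filter Topology MeasureTheory
open scoped NNReal ENNReal

noncomputable section

/-! ### The ring `ℂ{x, y}` of convergent power series -/

/-- A formal power series in two variables converges in a neighbourhood of the origin: it converges
absolutely on some closed polydisc `|x| ≤ r`, `|y| ≤ r` with `r > 0`. -/
def IsConvergentSeries (P : MvPowerSeries (Fin 2) ℂ) : Prop :=
  ∃ r : ℝ, 0 < r ∧ Summable fun n : Fin 2 →₀ ℕ => ‖MvPowerSeries.coeff n P‖ * (r ^ n 0 * r ^ n 1)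

theorem IsConvergentSeries.mono {P : MvPowerSeries (Fin 2) ℂ} {r s : ℝ} (hs : 0 ≤ s) (hsr : s ≤ r)
    (h : Summable fun n : Fin 2 →₀ ℕ => ‖MvPowerSeries.coeff n P‖ * (r ^ n 0 * r ^ n 1)) :
    Summable fun n : Fin 2 →₀ ℕ => ‖MvPowerSeries.coeff n P‖ * (s ^ n 0 * s ^ n 1) := by
  refine Summable.of_nonneg_of_le (fun n => by positivity) (fun n => ?_) h
  have := hs.trans hsr
  gcongr

theorem IsConvergentSeries.add {P Q : MvPowerSeries (Fin 2) ℂ} (hP : IsConvergentSeries P)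
    (hQ : IsConvergentSeries Q) : IsConvergentSeries (P + Q) := by
  obtain ⟨r, hr, hP⟩ := hP
  obtain ⟨s, hs, hQ⟩ := hQ
  have hm : 0 < min r s := lt_min hr hs
  refine ⟨min r s, hm, ?_⟩
  refine Summable.of_nonneg_of_le (fun n => by positivity) (fun n => ?_)
    ((IsConvergentSeries.mono hm.le (min_le_left r s) hP).add
      (IsConvergentSeries.mono hm.le (min_le_right r s) hQ))
  rw [← add_mul, map_add]
  gcongr
  exact norm_add_le _ _

theorem IsConvergentSeries.mul {P Q : MvPowerSeries (Fin 2) ℂ} (hP : IsConvergentSeries P)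
    (hQ : IsConvergentSeries Q) : IsConvergentSeries (P * Q) := by
  obtain ⟨r, hr, hP⟩ := hP
  obtain ⟨s, hs, hQ⟩ := hQ
  have hm : 0 < min r s := lt_min hr hs
  refine ⟨min r s, hm, ?_⟩
  have hP' := IsConvergentSeries.mono hm.le (min_le_left r s) hP
  have hQ' := IsConvergentSeries.mono hm.le (min_le_right r s) hQ
  generalize min r s = m at hm hP' hQ' ⊢
  have hnn : ∀ (S : MvPowerSeries (Fin 2) ℂ) (n : Fin 2 →₀ ℕ),
      0 ≤ ‖MvPowerSeries.coeff n S‖ * (m ^ n 0 * m ^ n 1) := fun S n => by positivity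
  have h := summable_sum_mul_antidiagonal_of_summable_mul
    (Summable.mul_of_nonneg hP' hQ' (hnn P) (hnn Q))
  refine Summable.of_nonneg_of_le (hnn _) (fun n => ?_) h
  rw [MvPowerSeries.coeff_mul]
  refine (mul_le_mul_of_nonneg_right (norm_sum_le _ _) (by positivity)).trans (le_of_eq ?_)
  rw [Finset.sum_mul]
  refine Finset.sum_congr rfl fun p hp => ?_
  rw [← Finset.HasAntidiagonal.mem_antidiagonal.mp hp, norm_mul, Finsupp.add_apply, Finsupp.add_apply, pow_add,
    pow_add]
  ring

theorem IsConvergentSeries.C (a : ℂ) : IsConvergentSeries (MvPowerSeries.C a) := by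
  refine ⟨1, one_pos, ?_⟩
  refine summable_of_ne_finset_zero (s := {0}) fun n hn => ?_
  have : n ≠ 0 := by simpa using hn
  classical
  simp [MvPowerSeries.coeff_C, this]

theorem IsConvergentSeries.neg {P : MvPowerSeries (Fin 2) ℂ} (hP : IsConvergentSeries P) :
    IsConvergentSeries (-P) := by
  obtain ⟨r, hr, hP⟩ := hP
  exact ⟨r, hr, by simpa using hP⟩

/-- The ring `ℂ{x, y}` of power series in `x, y` with complex coefficients that converge in some
neighbourhood of the origin. -/
def ConvergentPowerSeries : Subring (MvPowerSeries (Fin 2) ℂ) where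
  carrier := {P | IsConvergentSeries P}
  mul_mem' := IsConvergentSeries.mul
  one_mem' := by simpa using IsConvergentSeries.C 1
  add_mem' := IsConvergentSeries.add
  zero_mem' := by simpa using IsConvergentSeries.C 0
  neg_mem' := IsConvergentSeries.neg

/-- `P` is the power series expansion of the function `F` at the origin: it sums to `F (x, y)` for
all `(x, y)` near `(0, 0)`. -/
def IsExpansionAtZero (F : ℂ × ℂ → ℂ) (P : ConvergentPowerSeries) : Prop :=
  ∀ᶠ q : ℂ × ℂ in 𝓝 0, HasSum (fun n : Fin 2 →₀ ℕ =>
    MvPowerSeries.coeff n (P : MvPowerSeries (Fin 2) ℂ) * (q.1 ^ n 0 * q.2 ^ n 1)) (F q)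

/-- The germ of `F` at the origin is an irreducible element of `ℂ{x, y}`. -/
def IsIrreducibleGerm (F : ℂ × ℂ → ℂ) : Prop :=
  ∃ P : ConvergentPowerSeries, IsExpansionAtZero F P ∧ Irreducible P

/-! ### The volume of a complex curve in `ℂ²` -/

/-- A holomorphic parametrization of a part of `W ⊆ ℂ²` as a one-dimensional complex submanifold:
an injective holomorphic immersion of an open set `source ⊆ ℂ` into `ℂ²` that maps open subsets of
`source` to relatively open subsets of `W` (so it is a homeomorphism onto a relatively open subset
of `W`). The smooth locus of a complex curve `W` is the union of the images of all these
parametrizations. -/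
structure CurveChart (W : Set (ℂ × ℂ)) where
  source : Set ℂ
  toFun : ℂ → ℂ × ℂ
  isOpen_source : IsOpen source
  differentiableOn : DifferentiableOn ℂ toFun source
  injOn : InjOn toFun source
  deriv_ne_zero : ∀ z ∈ source, deriv toFun z ≠ 0
  isOpen_image : ∀ A ⊆ source, IsOpen A → ∃ O : Set (ℂ × ℂ), IsOpen O ∧ toFun '' A = W ∩ O

/-- The volume measure, on the image of the chart `φ`, of the metric induced by the Euclidean metric
`dx ⊗ dx̄ + dy ⊗ dȳ` of `ℂ²`. The real tangent vectors `φ'(z)` and `i φ'(z)` are orthogonal and have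
the same Euclidean length, so the square root of the determinant of the metric in the
chart is `|φ₁'(z)|² + |φ₂'(z)|²`. -/
def CurveChart.volume {W : Set (ℂ × ℂ)} (φ : CurveChart W) : Measure (ℂ × ℂ) :=
  (((MeasureTheory.volume : Measure ℂ).restrict φ.source).withDensity fun z =>
    ‖(deriv φ.toFun z).1‖ₑ ^ 2 + ‖(deriv φ.toFun z).2‖ₑ ^ 2).map φ.toFun

/-- The volume measure `dV_W` of the smooth locus of a complex curve `W ⊆ ℂ²` with the metric
induced by the Euclidean metric, as a measure on `ℂ²` (it gives no mass to the singular points and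
to the complement of `W`). The volume measures in the charts agree on overlaps, and `dV_W` is
obtained by gluing them: it is the least measure that dominates all of them. -/
def curveVolume (W : Set (ℂ × ℂ)) : Measure (ℂ × ℂ) :=
  ⨆ φ : CurveChart W, φ.volume

/-- The integral `∫_{W ∩ U} |f|^{-2c} dV_W`, with values in `[0, ∞]`, where `0 ^ (-2c) = ∞` if
`c > 0`. -/
def singularIntegral (W : Set (ℂ × ℂ)) (f : ℂ × ℂ → ℂ) (c : ℝ) (U : Set (ℂ × ℂ)) : ℝ≥0∞ :=
  ∫⁻ q in W ∩ U, ‖f q‖ₑ ^ (-2 * c) ∂(curveVolume W)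

/-- The complex singularity exponent at `p` of a function `f` on a (possibly singular) complex curve
`W`: the supremum of all `c ≥ 0` such that `∫_{W ∩ U} |f|^{-2c} dV_W < ∞` for some open
neighbourhood `U` of `p`. -/
def complexSingularityExponent (W : Set (ℂ × ℂ)) (f : ℂ × ℂ → ℂ) (p : ℂ × ℂ) : ℝ≥0∞ :=
  ⨆ (c : ℝ≥0) (_ : ∃ U : Set (ℂ × ℂ), IsOpen U ∧ p ∈ U ∧ singularIntegral W f c U < ∞), (c : ℝ≥0∞)

/-! ### The family `xy = t` -/

/-- The open polydisc `D₀(R, R)`. -/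
def polydisc (R : ℝ) : Set (ℂ × ℂ) := {q | ‖q.1‖ < R ∧ ‖q.2‖ < R}

/-- The fibre `X_t` over `t` of the map `π(x, y) = xy` on `X = D₀(R₀, R₀)`. -/
def fiber (R₀ : ℝ) (t : ℂ) : Set (ℂ × ℂ) := {q | q ∈ polydisc R₀ ∧ q.1 * q.2 = t}

end

/-!
For `t ≠ 0` the fibre `x y = t` is parametrized by `x ↦ (x, t / x)`, with volume form
`(1 + |t / x²|²) dA(x)`, and also by the second coordinate; the fibre over `0` is the union of the
two axes with Lebesgue measure. Away from the origin the fibre over `t` converges to the axes and `F`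
has no zeros there, so the integrals converge by dominated convergence
(`tendsto_lintegral_annulus`). It remains to show that the integrals over the part of the fibre in a
polydisc of radius `ε` tend to `0` with `ε`, uniformly in `t`
(`LeadingPart.exists_lintegral_polydisc_le`).

Let `p` and `q` be the orders of vanishing of `F` along the axes. As `c` is smaller than the
singularity exponent, `c p < 1` and `c q < 1`. The fibre is an orbit of the flow
`(x e^w, y e^{-w})`, and along the piece `|w| ≤ r` of the orbit, `F` is up to a small relative error
an exponential sum, with the frequency `a - b` for the monomial `x^a y^b`. The monomials that are
comparable in size to the largest one at a given point form an antichain for divisibility, so there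
are at most `p + 1` of them and their frequencies are distinct. By a Vandermonde argument some
derivative of order `k ≤ p` in `w` is at least a constant times the largest monomial, hence at least
a constant times `|x|^p` and `|y|^q` (`exists_le_norm_sum_monomial`). A holomorphic function with a
large derivative of order `k` is bounded below by a product of `k` linear factors
(`exists_prod_le_norm`), and so the integral of its power `-2c` is bounded when `k c < 1`. This
bounds the integral over every piece of orbit by a multiple of
`(|x|² + |y|²) max(|x|^p, |y|^q)^{-2c}`, and averaging over all pieces (`volume_mul_lintegral_eq`)
leaves two elementary integrals, of order `ε^{2-2cp}` and `ε^{2-2cq}`.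
-/

/-! ### Radial integrals over the plane -/

theorem lintegral_comp_norm {g : ℝ → ℝ≥0∞} (hg : Measurable g) :
    ∫⁻ v : ℂ, g ‖v‖ = ENNReal.ofReal (2 * Real.pi) * ∫⁻ r in Ioi (0 : ℝ), ENNReal.ofReal r * g r := by
  rw [← Complex.lintegral_comp_polarCoord_symm]
  have h1 : ∀ p : ℝ × ℝ, p ∈ polarCoord.target →
      ENNReal.ofReal p.1 • g ‖Complex.polarCoord.symm p‖ = ENNReal.ofReal p.1 * g p.1 := by
    intro p hp
    have : 0 < p.1 := hp.1
    rw [Complex.norm_polarCoord_symm, abs_of_pos this, smul_eq_mul]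
  rw [setLIntegral_congr_fun polarCoord.open_target.measurableSet h1]
  rw [polarCoord_target, Measure.volume_eq_prod, ← Measure.prod_restrict]
  rw [lintegral_prod _ (by fun_prop)]
  simp only [lintegral_const, MeasurableSet.univ, Measure.restrict_apply, univ_inter,
    Real.volume_Ioo]
  rw [lintegral_mul_const _ (by fun_prop), mul_comm]
  congr 2
  ring

theorem lintegral_ball_norm_rpow {s ε : ℝ} (hs : -2 < s) (hε : 0 < ε) :
    ∫⁻ v in Metric.ball (0 : ℂ) ε, ENNReal.ofReal (‖v‖ ^ s) =
      ENNReal.ofReal (2 * Real.pi * (ε ^ (s + 2) / (s + 2))) := by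
  have h1 : ∫⁻ v in Metric.ball (0 : ℂ) ε, ENNReal.ofReal (‖v‖ ^ s) =
      ∫⁻ v : ℂ, (Iio ε).indicator (fun r => ENNReal.ofReal (r ^ s)) ‖v‖ := by
    rw [← lintegral_indicator measurableSet_ball]
    refine lintegral_congr fun v => ?_
    simp [indicator]
  have h2 : ∫⁻ r in Ioi (0 : ℝ), ENNReal.ofReal r *
      (Iio ε).indicator (fun r => ENNReal.ofReal (r ^ s)) r =
      ∫⁻ r in Ioo (0 : ℝ) ε, ENNReal.ofReal (r ^ (s + 1)) := by
    rw [← lintegral_indicator measurableSet_Ioi, ← lintegral_indicator measurableSet_Ioo]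
    refine lintegral_congr fun r => ?_
    by_cases h0 : 0 < r <;> by_cases h1 : r < ε <;> simp [indicator, h0, h1]
    rw [← ENNReal.ofReal_mul h0.le, Real.rpow_add h0, Real.rpow_one, mul_comm]
  rw [h1, lintegral_comp_norm (by fun_prop (disch := measurability)), h2,
    setLIntegral_congr (Ioo_ae_eq_Ioc (μ := volume)),
    ← ofReal_integral_eq_lintegral_ofReal, ← intervalIntegral.integral_of_le hε.le,
    integral_rpow (Or.inl (by linarith)), ← ENNReal.ofReal_mul (by positivity)]
  · rw [Real.zero_rpow (by linarith)]
    ring_nf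
  · exact (intervalIntegrable_iff_integrableOn_Ioc_of_le hε.le).1
      (intervalIntegral.intervalIntegrable_rpow' (by linarith))
  · filter_upwards [ae_restrict_mem measurableSet_Ioc] with r hr
    exact Real.rpow_nonneg hr.1.le _

theorem lintegral_compl_closedBall_norm_rpow {s ε : ℝ} (hs : s < -2) (hε : 0 < ε) :
    ∫⁻ v in (Metric.closedBall (0 : ℂ) ε)ᶜ, ENNReal.ofReal (‖v‖ ^ s) =
      ENNReal.ofReal (2 * Real.pi * (-ε ^ (s + 2) / (s + 2))) := by
  have h1 : ∫⁻ v in (Metric.closedBall (0 : ℂ) ε)ᶜ, ENNReal.ofReal (‖v‖ ^ s) =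
      ∫⁻ v : ℂ, (Ioi ε).indicator (fun r => ENNReal.ofReal (r ^ s)) ‖v‖ := by
    rw [← lintegral_indicator measurableSet_closedBall.compl]
    refine lintegral_congr fun v => ?_
    simp [indicator]
  have h2 : ∫⁻ r in Ioi (0 : ℝ), ENNReal.ofReal r *
      (Ioi ε).indicator (fun r => ENNReal.ofReal (r ^ s)) r =
      ∫⁻ r in Ioi ε, ENNReal.ofReal (r ^ (s + 1)) := by
    rw [← lintegral_indicator measurableSet_Ioi, ← lintegral_indicator measurableSet_Ioi]
    refine lintegral_congr fun r => ?_
    by_cases h1 : ε < r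
    · have h0 : 0 < r := hε.trans h1
      simp [indicator, h0, h1]
      rw [← ENNReal.ofReal_mul h0.le, Real.rpow_add h0, Real.rpow_one, mul_comm]
    · simp [indicator, h1]
  rw [h1, lintegral_comp_norm (by fun_prop (disch := measurability)), h2,
    ← ofReal_integral_eq_lintegral_ofReal,
    integral_Ioi_rpow_of_lt (by linarith) hε, ← ENNReal.ofReal_mul (by positivity)]
  · ring_nf
  · exact integrableOn_Ioi_rpow_of_lt (by linarith) hε
  · filter_upwards [ae_restrict_mem measurableSet_Ioi] with r hr
    exact Real.rpow_nonneg (hε.trans hr).le _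

theorem lintegral_ball_norm_rpow_eq_top {s ε : ℝ} (hs : s ≤ -2) (hε : 0 < ε) :
    ∫⁻ v in Metric.ball (0 : ℂ) ε, ENNReal.ofReal (‖v‖ ^ s) = ∞ := by
  by_contra h
  have hi : IntegrableOn (fun v : ℂ => ‖v‖ ^ s) (Metric.ball 0 ε) := by
    refine ⟨Measurable.aestronglyMeasurable (by fun_prop), ?_⟩
    rw [hasFiniteIntegral_iff_norm]
    simp_rw [Real.norm_of_nonneg (Real.rpow_nonneg (norm_nonneg _) _)]
    exact lt_top_iff_ne_top.2 h
  have := (integrableOn_fun_norm_addHaar (E := ℂ) volume (f := fun r : ℝ => r ^ s)).1 hi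
  rw [Complex.finrank_real_complex] at this
  have h2 : IntegrableOn (fun r : ℝ => r ^ (s + 1)) (Ioo 0 ε) := by
    refine this.congr_fun (fun r hr => ?_) measurableSet_Ioo
    have : 0 < r := hr.1
    simp [Real.rpow_add this, mul_comm]
  rw [intervalIntegral.integrableOn_Ioo_rpow_iff hε] at h2
  linarith

/-! ### Negative powers of holomorphic functions of one variable -/

theorem iteratedDeriv_succ_sub_mul {g f : ℂ → ℂ} {U : Set ℂ} (hU : IsOpen U)
    (hg : DifferentiableOn ℂ g U) {z b : ℂ} (hf : ∀ w ∈ U, f w = b + (w - z) * g w) (n : ℕ) :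
    ∀ w ∈ U, iteratedDeriv (n + 1) f w =
      (w - z) * iteratedDeriv (n + 1) g w + (n + 1) * iteratedDeriv n g w := by
  have hd : ∀ m, DifferentiableOn ℂ (iteratedDeriv m g) U := fun m => by
    rw [iteratedDeriv_eq_iterate]
    exact ((hg.analyticOnNhd hU).iterated_deriv m).differentiableOn
  have hda : ∀ m, ∀ w ∈ U, HasDerivAt (iteratedDeriv m g) (iteratedDeriv (m + 1) g w) w := by
    intro m w hw
    rw [iteratedDeriv_succ]
    exact ((hd m).differentiableAt (hU.mem_nhds hw)).hasDerivAt
  induction n with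
  | zero =>
    intro w hw
    have h1 : HasDerivAt (fun w => b + (w - z) * g w)
        (1 * g w + (w - z) * iteratedDeriv 1 g w) w := by
      have := hda 0 w hw
      rw [iteratedDeriv_zero] at this
      exact (((hasDerivAt_id w).sub_const z).mul this).const_add b
    rw [zero_add, iteratedDeriv_one (f := f), EqOn.deriv (f := f) (g := _) hf hU hw, h1.deriv]
    simp
    ring
  | succ n ih =>
    intro w hw
    rw [iteratedDeriv_succ (f := f), EqOn.deriv (f := iteratedDeriv (n + 1) f) ih hU hw]
    have h1 := (((hasDerivAt_id w).sub_const z).mul (hda (n + 1) w hw)).add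
      ((hda n w hw).const_mul ((n : ℂ) + 1))
    refine h1.deriv.trans ?_
    push_cast
    simp
    ring

/-- If the derivative of order `n + 1` of `b + (w - z) g(w)` is close to `a`, then the derivative of
order `n` of `g` is close to `a / (n + 1)`: integrate along the segment from `z`. -/
theorem norm_iteratedDeriv_sub_le {g f : ℂ → ℂ} {U K : Set ℂ} (hU : IsOpen U) (hK : Convex ℝ K)
    (hKU : K ⊆ U) (hg : DifferentiableOn ℂ g U) {z b : ℂ} (hz : z ∈ K)
    (hf : ∀ w ∈ U, f w = b + (w - z) * g w) (n : ℕ) {a : ℂ} {η : ℝ}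
    (h : ∀ w ∈ K, ‖iteratedDeriv (n + 1) f w - a‖ ≤ η) :
    ∀ w ∈ K, ‖iteratedDeriv n g w - a / (n + 1)‖ ≤ η / (n + 1) := by
  intro w hw
  have hn : (n + 1 : ℂ) ≠ 0 := by exact_mod_cast n.succ_ne_zero
  have hn' : (0 : ℝ) < n + 1 := by positivity
  set γ : ℝ → ℂ := fun s => z + s * (w - z) with hγ
  have hγK : ∀ s ∈ Icc (0 : ℝ) 1, γ s ∈ K := fun s hs => by
    have := hK.add_smul_sub_mem hz hw hs
    simpa [hγ] using this
  have hγd : ∀ s, HasDerivAt γ (w - z) s := fun s => by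
    have := ((Complex.ofRealCLM.hasDerivAt (x := s)).mul_const (w - z)).const_add z
    simpa [hγ] using this
  have hd : ∀ s ∈ Icc (0 : ℝ) 1, HasDerivAt
      (fun s : ℝ => (s : ℂ) ^ (n + 1) * (iteratedDeriv n g (γ s) - a / (n + 1)))
      ((s : ℂ) ^ n * (iteratedDeriv (n + 1) f (γ s) - a)) s := by
    intro s hs
    have hm := hKU (hγK s hs)
    have h1 : HasDerivAt (iteratedDeriv n g) (iteratedDeriv (n + 1) g (γ s)) (γ s) := by
      rw [iteratedDeriv_succ, iteratedDeriv_eq_iterate]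
      exact (((hg.analyticOnNhd hU).iterated_deriv n).differentiableOn.differentiableAt
        (hU.mem_nhds hm)).hasDerivAt
    have h2 := (h1.comp s (hγd s)).sub_const (a / (n + 1))
    have h3 : HasDerivAt (fun s : ℝ => (s : ℂ) ^ (n + 1)) (((n + 1 : ℕ) : ℂ) * (s : ℂ) ^ n) s := by
      have := (Complex.ofRealCLM.hasDerivAt (x := s)).pow (n + 1)
      refine this.congr_deriv ?_
      simp
    refine (h3.mul h2).congr_deriv ?_
    rw [iteratedDeriv_succ_sub_mul hU hg hf n _ hm]
    simp only [hγ, Function.comp]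
    push_cast
    field_simp
    ring
  have key := image_norm_le_of_norm_deriv_right_le_deriv_boundary (a := 0) (b := 1)
    (B := fun s => η * s ^ (n + 1) / (n + 1)) (B' := fun s => s ^ n * η)
    (fun s hs => (hd s hs).continuousAt.continuousWithinAt)
    (fun s hs => (hd s (Ico_subset_Icc_self hs)).hasDerivWithinAt) (by simp)
    (fun s => by
      have := (((hasDerivAt_id s).pow (n + 1)).const_mul η).div_const ((n : ℝ) + 1)
      refine this.congr_deriv ?_
      simp
      field_simp)
    (fun s hs => by
      rw [norm_mul, norm_pow, Complex.norm_real, Real.norm_of_nonneg hs.1]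
      exact mul_le_mul_of_nonneg_left (h _ (hγK s (Ico_subset_Icc_self hs)))
        (pow_nonneg hs.1 _))
    (right_mem_Icc.2 zero_le_one)
  simpa [hγ] using key

/-- A holomorphic function whose derivative of order `k` is nearly constant on a disc is bounded
below there by a product of `k` linear factors. The zeros of the factors are found one after the
other: if `|f|` is smallest at `z`, then `2 |f(w)| ≥ |f(w) - f(z)|`, and `(f(w) - f(z)) / (w - z)`
satisfies the same hypothesis with `k - 1`. -/
theorem exists_prod_le_norm {r : ℝ} (hr : 0 < r) {U : Set ℂ} (hU : IsOpen U)
    (hKU : Metric.closedBall 0 r ⊆ U) (k : ℕ) : ∀ (f : ℂ → ℂ) (a : ℂ), DifferentiableOn ℂ f U →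
    (∀ w ∈ Metric.closedBall (0 : ℂ) r, ‖iteratedDeriv k f w - a‖ ≤ ‖a‖ / 2) →
    ∃ z : Fin k → ℂ, (∀ i, z i ∈ Metric.closedBall (0 : ℂ) r) ∧
      ∀ w ∈ Metric.closedBall (0 : ℂ) r,
        ‖a‖ / (2 ^ (k + 1) * k.factorial) * ∏ i, ‖w - z i‖ ≤ ‖f w‖ := by
  induction k with
  | zero =>
    intro f a _ h
    refine ⟨Fin.elim0, fun i => i.elim0, fun w hw => ?_⟩
    have h1 := h w hw
    rw [iteratedDeriv_zero] at h1
    have h2 := norm_sub_norm_le a (f w)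
    rw [norm_sub_rev] at h2
    simp
    linarith
  | succ k ih =>
    intro f a hf h
    obtain ⟨z, hz, hmin⟩ := (isCompact_closedBall (0 : ℂ) r).exists_isMinOn
      ⟨0, Metric.mem_closedBall_self hr.le⟩ (hf.continuousOn.norm.mono hKU)
    have hg : DifferentiableOn ℂ (dslope f z) U :=
      (Complex.differentiableOn_dslope (hU.mem_nhds (hKU hz))).2 hf
    have hfg : ∀ w ∈ U, f w = f z + (w - z) * dslope f z w := fun w _ => by
      have := sub_smul_dslope f z w
      rw [smul_eq_mul] at this
      rw [this]; ring
    have hk : (0 : ℝ) < k + 1 := by positivity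
    have hnk : ‖(k + 1 : ℂ)‖ = k + 1 := by
      have : (k + 1 : ℂ) = ((k + 1 : ℝ) : ℂ) := by push_cast; rfl
      rw [this, Complex.norm_real, Real.norm_of_nonneg hk.le]
    obtain ⟨y, hy, hprod⟩ := ih (dslope f z) (a / (k + 1)) hg (fun w hw => by
      have := norm_iteratedDeriv_sub_le hU (convex_closedBall 0 r) hKU hg hz hfg k h w hw
      refine this.trans (le_of_eq ?_)
      rw [norm_div, hnk]; ring)
    refine ⟨Fin.cons z y, fun i => ?_, fun w hw => ?_⟩
    · refine Fin.cases ?_ (fun j => ?_) i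
      · simpa using hz
      · simpa using hy j
    · have h1 := hprod w hw
      rw [norm_div, hnk] at h1
      have h2 : ‖w - z‖ * ‖dslope f z w‖ ≤ 2 * ‖f w‖ := by
        have h3 : ‖f z‖ ≤ ‖f w‖ := hmin hw
        rw [← norm_mul, ← smul_eq_mul, sub_smul_dslope]
        linarith [norm_sub_le (f w) (f z)]
      rw [Fin.prod_univ_succ]
      simp only [Fin.cons_zero, Fin.cons_succ]
      have h4 := mul_le_mul_of_nonneg_left h1 (norm_nonneg (w - z))
      rw [Nat.factorial_succ]
      push_cast
      calc _ = ‖w - z‖ * (‖a‖ / (k + 1) / (2 ^ (k + 1) * k.factorial) * ∏ i, ‖w - y i‖) / 2 := by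
            field_simp
            ring
        _ ≤ _ := by linarith

theorem ENNReal.rpow_le_rpow_of_base_le {x y : ℝ≥0∞} {s : ℝ} (hs : s ≤ 0) (h : x ≤ y) :
    y ^ s ≤ x ^ s := by
  rw [← neg_neg s, ENNReal.rpow_neg, ENNReal.rpow_neg x]
  exact ENNReal.inv_le_inv.2 (ENNReal.rpow_le_rpow h (by linarith))

theorem ENNReal.prod_le_one_add_sum_pow {ι : Type*} (s : Finset ι) (b : ι → ℝ≥0∞) :
    ∏ i ∈ s, b i ≤ 1 + ∑ i ∈ s, b i ^ s.card := by
  rcases s.eq_empty_or_nonempty with rfl | hs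
  · simp
  · obtain ⟨i, hi, hmax⟩ := s.exists_max_image b hs
    calc _ ≤ b i ^ s.card := Finset.prod_le_pow_card _ _ _ hmax
      _ ≤ ∑ i ∈ s, b i ^ s.card :=
        Finset.single_le_sum (f := fun i => b i ^ s.card) (fun _ _ => zero_le) hi
      _ ≤ _ := le_add_self

theorem enorm_rpow_eq_ofReal {z : ℂ} (hz : z ≠ 0) (s : ℝ) :
    ‖z‖ₑ ^ s = ENNReal.ofReal (‖z‖ ^ s) := by
  rw [← ofReal_norm, ENNReal.ofReal_rpow_of_pos (norm_pos_iff.2 hz)]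

theorem lintegral_closedBall_sub_rpow_le {r s : ℝ} (hr : 0 < r) (hs : -2 < s) {z : ℂ}
    (hz : z ∈ Metric.closedBall (0 : ℂ) r) :
    ∫⁻ w in Metric.closedBall (0 : ℂ) r, ‖w - z‖ₑ ^ s ≤
      ENNReal.ofReal (2 * Real.pi * ((3 * r) ^ (s + 2) / (s + 2))) := by
  rw [← lintegral_ball_norm_rpow hs (by positivity),
    ← lintegral_indicator measurableSet_closedBall, ← lintegral_indicator measurableSet_ball,
    ← lintegral_sub_right_eq_self (μ := volume) (indicator _ fun v => ENNReal.ofReal (‖v‖ ^ s)) z]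
  refine lintegral_mono_ae ?_
  filter_upwards [compl_mem_ae_iff.2 (measure_singleton (μ := volume) z)] with w hw
  have hwz : w - z ≠ 0 := sub_ne_zero.2 hw
  by_cases h : w ∈ Metric.closedBall (0 : ℂ) r
  · have h1 : w - z ∈ Metric.ball (0 : ℂ) (3 * r) := by
      simp only [mem_closedBall_zero_iff, mem_ball_zero_iff] at *
      linarith [norm_sub_le w z]
    rw [indicator_of_mem h, indicator_of_mem h1, enorm_rpow_eq_ofReal hwz]
  · rw [indicator_of_notMem h]
    exact zero_le

/-- If `k c < 1` and the derivative of order `k` of `f` is close to `a` on a disc, then the integral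
of `|f|^{-2c}` over the disc is at most a constant times `|a|^{-2c}`. -/
theorem exists_lintegral_rpow_neg_le {r c : ℝ} (hr : 0 < r) (hc : 0 < c) (k : ℕ) (hk : k * c < 1) :
    ∃ C : ℝ≥0, ∀ (U : Set ℂ) (f : ℂ → ℂ) (a : ℂ), IsOpen U → Metric.closedBall 0 r ⊆ U →
      DifferentiableOn ℂ f U →
      (∀ w ∈ Metric.closedBall (0 : ℂ) r, ‖iteratedDeriv k f w - a‖ ≤ ‖a‖ / 2) →
      ∫⁻ w in Metric.closedBall (0 : ℂ) r, ‖f w‖ₑ ^ (-2 * c) ≤ C * ‖a‖ₑ ^ (-2 * c) := by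
  set A : ℝ := (2 ^ (k + 1) * k.factorial : ℝ)⁻¹ with hA
  have hA0 : 0 < A := by positivity
  set V : ℝ≥0∞ := volume (Metric.closedBall (0 : ℂ) r) + k * ENNReal.ofReal
    (2 * Real.pi * ((3 * r) ^ (-2 * c * k + 2) / (-2 * c * k + 2))) with hV
  have hVtop : V ≠ ∞ := by
    refine ENNReal.add_ne_top.2 ⟨measure_closedBall_lt_top.ne, ?_⟩
    exact ENNReal.mul_ne_top (ENNReal.natCast_ne_top k) ENNReal.ofReal_ne_top
  refine ⟨(ENNReal.ofReal (A ^ (-2 * c)) * V).toNNReal, fun U f a hU hKU hf h => ?_⟩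
  rw [ENNReal.coe_toNNReal (ENNReal.mul_ne_top ENNReal.ofReal_ne_top hVtop)]
  obtain ⟨z, hz, hle⟩ := exists_prod_le_norm hr hU hKU k f a hf h
  have hpt : ∀ w ∈ Metric.closedBall (0 : ℂ) r, ‖f w‖ₑ ^ (-2 * c) ≤
      ENNReal.ofReal (A ^ (-2 * c)) * ‖a‖ₑ ^ (-2 * c) *
        (1 + ∑ i, ‖w - z i‖ₑ ^ (-2 * c * k)) := by
    intro w hw
    have h1 : ENNReal.ofReal A * ‖a‖ₑ * ∏ i, ‖w - z i‖ₑ ≤ ‖f w‖ₑ := by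
      have h2 := ENNReal.ofReal_le_ofReal (hle w hw)
      rw [ENNReal.ofReal_mul (by positivity), div_eq_inv_mul, ENNReal.ofReal_mul (by positivity),
        ENNReal.ofReal_prod_of_nonneg (fun _ _ => norm_nonneg _)] at h2
      simpa only [ofReal_norm] using h2
    have hneg : -2 * c ≤ 0 := by linarith
    calc ‖f w‖ₑ ^ (-2 * c) ≤ (ENNReal.ofReal A * ‖a‖ₑ * ∏ i, ‖w - z i‖ₑ) ^ (-2 * c) :=
          ENNReal.rpow_le_rpow_of_base_le hneg h1
      _ = ENNReal.ofReal (A ^ (-2 * c)) * ‖a‖ₑ ^ (-2 * c) * ∏ i, ‖w - z i‖ₑ ^ (-2 * c) := by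
        rw [ENNReal.mul_rpow_of_ne_top, ENNReal.mul_rpow_of_ne_top, ENNReal.prod_rpow_of_ne_top,
          ENNReal.ofReal_rpow_of_pos hA0]
        · exact fun _ _ => enorm_ne_top
        · exact ENNReal.ofReal_ne_top
        · exact enorm_ne_top
        · exact ENNReal.mul_ne_top ENNReal.ofReal_ne_top enorm_ne_top
        · exact ENNReal.prod_ne_top fun _ _ => enorm_ne_top
      _ ≤ _ := by
        gcongr
        refine (ENNReal.prod_le_one_add_sum_pow _ _).trans (le_of_eq ?_)
        simp only [Finset.card_univ, Fintype.card_fin, ENNReal.rpow_mul_natCast]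
  refine (setLIntegral_mono' measurableSet_closedBall hpt).trans ?_
  rw [lintegral_const_mul _ (by fun_prop), lintegral_add_left (by fun_prop),
    lintegral_finsetSum _ (by fun_prop)]
  have h3 : ∑ i, ∫⁻ w in Metric.closedBall (0 : ℂ) r, ‖w - z i‖ₑ ^ (-2 * c * k) ≤
      k * ENNReal.ofReal (2 * Real.pi * ((3 * r) ^ (-2 * c * k + 2) / (-2 * c * k + 2))) := by
    refine (Finset.sum_le_card_nsmul _ _ _ fun i _ =>
      lintegral_closedBall_sub_rpow_le hr (s := -2 * c * k) (by nlinarith) (hz i)).trans ?_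
    simp
  rw [mul_right_comm]
  gcongr
  rw [setLIntegral_one]
  exact add_le_add le_rfl h3

/-! ### The volume measure of a curve in a chart -/

theorem ContinuousOn.measurableSet_inter_preimage {X Y : Type*} [TopologicalSpace X]
    [MeasurableSpace X] [OpensMeasurableSpace X] [TopologicalSpace Y] [MeasurableSpace Y]
    [BorelSpace Y] {g : X → Y} {T : Set X} (hT : MeasurableSet T) (hg : ContinuousOn g T)
    {B : Set Y} (hB : MeasurableSet B) : MeasurableSet (T ∩ g ⁻¹' B) := by
  have hg' : Continuous (T.domRestrict g) := continuousOn_iff_continuous_domRestrict.1 hg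
  have := hT.subtype_image (hg'.measurable hB)
  convert this using 1
  ext x
  simp [Set.domRestrict, and_comm]

theorem lintegral_image_eq_lintegral_enorm_deriv_sq_mul {g : ℂ → ℂ} {T : Set ℂ}
    (hT : MeasurableSet T) (hd : ∀ z ∈ T, DifferentiableAt ℂ g z) (hg : InjOn g T)
    (f : ℂ → ℝ≥0∞) :
    ∫⁻ x in g '' T, f x = ∫⁻ z in T, ‖deriv g z‖ₑ ^ 2 * f (g z) := by
  rw [lintegral_image_eq_lintegral_abs_det_fderiv_mul volume hT
    (fun z hz => ((hd z hz).hasDerivAt.complexToReal_fderiv).hasFDerivWithinAt) hg]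
  refine lintegral_congr fun z => ?_
  congr 1
  have h1 : (deriv g z • (1 : ℂ →L[ℝ] ℂ)).det = ‖deriv g z‖ ^ 2 := by
    rw [← Complex.normSq_eq_norm_sq, ← Algebra.norm_complex_apply, Algebra.norm_apply]
    change LinearMap.det _ = LinearMap.det _
    congr 1
  rw [h1, abs_of_nonneg (by positivity), ENNReal.ofReal_pow (norm_nonneg _), ofReal_norm]

namespace CurveChart

variable {W : Set (ℂ × ℂ)}

theorem mem_of_mem_source (φ : CurveChart W) {z : ℂ} (hz : z ∈ φ.source) : φ.toFun z ∈ W := by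
  obtain ⟨O, -, hO⟩ := φ.isOpen_image φ.source subset_rfl φ.isOpen_source
  exact (hO ▸ mem_image_of_mem φ.toFun hz : φ.toFun z ∈ W ∩ O).1

/-- The density of the volume measure in the coordinate of the chart. -/
noncomputable def density (φ : CurveChart W) (z : ℂ) : ℝ≥0∞ :=
  ‖(deriv φ.toFun z).1‖ₑ ^ 2 + ‖(deriv φ.toFun z).2‖ₑ ^ 2

theorem measurable_density (φ : CurveChart W) : Measurable φ.density := by
  have := measurable_deriv φ.toFun
  unfold density
  fun_prop

theorem volume_apply (φ : CurveChart W) {B : Set (ℂ × ℂ)} (hB : MeasurableSet B) :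
    φ.volume B = ∫⁻ z in φ.toFun ⁻¹' B ∩ φ.source, φ.density z := by
  have hs := φ.isOpen_source.measurableSet
  have h1 : AEMeasurable φ.toFun
      ((MeasureTheory.volume.restrict φ.source).withDensity φ.density) :=
    (φ.differentiableOn.continuousOn.aemeasurable hs).mono_ac (withDensity_absolutelyContinuous _ _)
  have h2 : φ.volume = ((MeasureTheory.volume.restrict φ.source).withDensity φ.density).map
    φ.toFun := rfl
  rw [h2, Measure.map_apply_of_aemeasurable h1 hB, withDensity_apply', Measure.restrict_restrict' hs]

/-- The volumes in two charts agree: where the chart `ψ` factors through the chart `φ`, the first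
volume is at most the second. The coordinate change is holomorphic because the inverse of `φ` is the
restriction of a linear map `e`. -/
theorem lintegral_density_le (φ ψ : CurveChart W) (e : ℂ × ℂ →L[ℂ] ℂ)
    (he : ∀ z ∈ φ.source, e (φ.toFun z) = z) {T : Set ℂ} (hT : IsOpen T)
    (hTψ : T ⊆ ψ.source) (hTφ : ∀ z ∈ T, ψ.toFun z ∈ φ.toFun '' φ.source)
    {B : Set (ℂ × ℂ)} (hB : MeasurableSet B) :
    ∫⁻ z in ψ.toFun ⁻¹' B ∩ T, ψ.density z ≤ φ.volume B := by
  have hfac : ∀ z ∈ T, e (ψ.toFun z) ∈ φ.source ∧ φ.toFun (e (ψ.toFun z)) = ψ.toFun z := by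
    intro z hz
    obtain ⟨x, hx, hxz⟩ := hTφ z hz
    rw [← hxz, he x hx]
    exact ⟨hx, rfl⟩
  have hψd : ∀ z ∈ T, DifferentiableAt ℂ ψ.toFun z := fun z hz =>
    ψ.differentiableOn.differentiableAt (ψ.isOpen_source.mem_nhds (hTψ hz))
  have hgd : ∀ z ∈ T, DifferentiableAt ℂ (fun z => e (ψ.toFun z)) z := fun z hz =>
    e.differentiableAt.comp z (hψd z hz)
  have hinj : InjOn (fun z => e (ψ.toFun z)) T := by
    intro z hz z' hz' h
    refine ψ.injOn (hTψ hz) (hTψ hz') ?_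
    rw [← (hfac z hz).2, ← (hfac z' hz').2]
    exact congrArg φ.toFun h
  have hmeas : MeasurableSet (ψ.toFun ⁻¹' B ∩ T) := by
    rw [inter_comm]
    exact (ψ.differentiableOn.continuousOn.mono hTψ).measurableSet_inter_preimage hT.measurableSet hB
  have hsub : ψ.toFun ⁻¹' B ∩ T ⊆ T := inter_subset_right
  rw [volume_apply φ hB]
  refine le_trans (le_of_eq ?_) (lintegral_mono_set (s := (fun z => e (ψ.toFun z)) ''
    (ψ.toFun ⁻¹' B ∩ T)) ?_)
  · rw [lintegral_image_eq_lintegral_enorm_deriv_sq_mul hmeas (fun z hz => hgd z (hsub hz))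
      (hinj.mono hsub)]
    refine setLIntegral_congr_fun hmeas fun z hz => ?_
    have hz' := hsub hz
    have hev : ψ.toFun =ᶠ[𝓝 z] φ.toFun ∘ fun z => e (ψ.toFun z) := by
      filter_upwards [hT.mem_nhds hz'] with y hy using ((hfac y hy).2).symm
    have hφd : DifferentiableAt ℂ φ.toFun (e (ψ.toFun z)) :=
      φ.differentiableOn.differentiableAt (φ.isOpen_source.mem_nhds (hfac z hz').1)
    have hder : deriv ψ.toFun z =
        deriv (fun z => e (ψ.toFun z)) z • deriv φ.toFun (e (ψ.toFun z)) := by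
      rw [hev.deriv_eq]
      exact (hφd.hasDerivAt.scomp z (hgd z hz').hasDerivAt).deriv
    unfold density
    rw [hder]
    simp only [Prod.smul_fst, Prod.smul_snd, smul_eq_mul, enorm_mul, mul_pow]
    rw [mul_add]
  · rintro _ ⟨z, hz, rfl⟩
    refine ⟨?_, (hfac z hz.2).1⟩
    change φ.toFun (e (ψ.toFun z)) ∈ B
    rw [(hfac z hz.2).2]
    exact hz.1

/-- A measurable bijective chart computes integrals over the part of `W` that it covers. -/
theorem lintegral_volume (φ : CurveChart W) (hφ : MeasurableEmbedding φ.toFun) (U : Set (ℂ × ℂ))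
    (f : ℂ × ℂ → ℝ≥0∞) :
    ∫⁻ q in W ∩ U, f q ∂φ.volume =
      ∫⁻ z in φ.source ∩ φ.toFun ⁻¹' U, f (φ.toFun z) * φ.density z := by
  have hs := φ.isOpen_source.measurableSet
  have h2 : φ.volume = ((MeasureTheory.volume.restrict φ.source).withDensity φ.density).map
    φ.toFun := rfl
  rw [h2, hφ.restrict_map, hφ.lintegral_map, restrict_withDensity',
    lintegral_withDensity_eq_lintegral_mul_non_measurable _ φ.measurable_density,
    Measure.restrict_restrict' hs]
  · have : φ.toFun ⁻¹' (W ∩ U) ∩ φ.source = φ.source ∩ φ.toFun ⁻¹' U := by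
      ext z
      constructor
      · exact fun h => ⟨h.2, h.1.2⟩
      · exact fun h => ⟨⟨φ.mem_of_mem_source h.1, h.2⟩, h.1⟩
    rw [this]
    simp [mul_comm]
  · refine Eventually.of_forall fun z => ?_
    unfold density
    simp

/-- A chart that covers the whole curve computes its volume measure. -/
theorem curveVolume_eq (φ : CurveChart W) (e : ℂ × ℂ →L[ℂ] ℂ)
    (he : ∀ z ∈ φ.source, e (φ.toFun z) = z) (hW : W ⊆ φ.toFun '' φ.source) :
    curveVolume W = φ.volume := by
  refine le_antisymm (iSup_le fun ψ => Measure.le_iff.2 fun B hB => ?_) (le_iSup _ φ)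
  rw [volume_apply ψ hB]
  exact lintegral_density_le φ ψ e he ψ.isOpen_source subset_rfl
    (fun z hz => hW (ψ.mem_of_mem_source hz)) hB

end CurveChart


/-! ### The fibres of `(x, y) ↦ x y` -/

theorem isOpen_polydisc (R : ℝ) : IsOpen (polydisc R) :=
  (isOpen_lt continuous_fst.norm continuous_const).inter
    (isOpen_lt continuous_snd.norm continuous_const)

theorem swap_mem_polydisc {R : ℝ} {q : ℂ × ℂ} : q.swap ∈ polydisc R ↔ q ∈ polydisc R :=
  and_comm

theorem isOpen_punctured_preimage {Φ : ℂ → ℂ × ℂ} (hΦ : ContinuousOn Φ {0}ᶜ) (R : ℝ) :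
    IsOpen {x : ℂ | x ≠ 0 ∧ Φ x ∈ polydisc R} :=
  hΦ.isOpen_inter_preimage isOpen_compl_singleton (isOpen_polydisc R)

theorem hasDerivAt_const_div (t : ℂ) {x : ℂ} (hx : x ≠ 0) :
    HasDerivAt (fun x : ℂ => t / x) (-t / x ^ 2) x := by
  refine ((hasDerivAt_const x t).div (hasDerivAt_id x) hx).congr_deriv ?_
  simp

/-- The parametrization `x ↦ (x, t / x)` of the fibre over `t ≠ 0`; for `t = 0` it is a
parametrization of the punctured `x`-axis, because then `t / x = 0`. -/
noncomputable def fiberChart (R₀ : ℝ) (t : ℂ) : CurveChart (fiber R₀ t) where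
  source := {x | x ≠ 0 ∧ (x, t / x) ∈ polydisc R₀}
  toFun x := (x, t / x)
  isOpen_source := isOpen_punctured_preimage (Φ := fun x => (x, t / x))
    (fun x hx => (continuousAt_id.prodMk
      (hasDerivAt_const_div t hx).continuousAt).continuousWithinAt) R₀
  differentiableOn x hx := ((hasDerivAt_id x).prodMk
    (hasDerivAt_const_div t hx.1)).differentiableAt.differentiableWithinAt
  injOn x _ y _ h := congrArg Prod.fst h
  deriv_ne_zero x hx h := by
    have := ((hasDerivAt_id x).prodMk (hasDerivAt_const_div t hx.1)).deriv
    exact one_ne_zero (congrArg Prod.fst (this.symm.trans h))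
  isOpen_image A hA hAo := by
    refine ⟨{q | q.1 ∈ A}, hAo.preimage continuous_fst, ?_⟩
    ext ⟨x, y⟩
    constructor
    · rintro ⟨z, hz, h⟩
      obtain ⟨rfl, rfl⟩ := Prod.mk.inj h
      exact ⟨⟨(hA hz).2, mul_div_cancel₀ _ (hA hz).1⟩, hz⟩
    · rintro ⟨⟨-, h⟩, hx : x ∈ A⟩
      refine ⟨x, hx, ?_⟩
      have hx0 := (hA hx).1
      have : t / x = y := by rw [← h]; field_simp
      simp [this]

theorem fiberChart_density {R₀ : ℝ} {t z : ℂ} (hz : z ≠ 0) :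
    (fiberChart R₀ t).density z = 1 + ‖t / z ^ 2‖ₑ ^ 2 := by
  have : deriv (fiberChart R₀ t).toFun z = (1, -t / z ^ 2) :=
    ((hasDerivAt_id z).prodMk (hasDerivAt_const_div t hz)).deriv
  unfold CurveChart.density
  rw [this, neg_div]
  simp

/-- The image of a chart under the exchange of the coordinates. -/
noncomputable def CurveChart.swap {R₀ : ℝ} {t : ℂ} (φ : CurveChart (fiber R₀ t)) :
    CurveChart (fiber R₀ t) where
  source := φ.source
  toFun z := (φ.toFun z).swap
  isOpen_source := φ.isOpen_source
  differentiableOn := φ.differentiableOn.snd.prodMk φ.differentiableOn.fst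
  injOn x hx y hy h := φ.injOn hx hy (Prod.swap_injective h)
  deriv_ne_zero x hx h := by
    have hd := (φ.differentiableOn.differentiableAt (φ.isOpen_source.mem_nhds hx)).hasDerivAt
    have h1 : HasDerivAt (fun z => (φ.toFun z).swap) (deriv φ.toFun x).swap x :=
      hd.snd.prodMk hd.fst
    refine φ.deriv_ne_zero x hx (Prod.swap_injective ?_)
    exact h1.deriv.symm.trans h
  isOpen_image A hA hAo := by
    obtain ⟨O, hO, h⟩ := φ.isOpen_image A hA hAo
    refine ⟨Prod.swap ⁻¹' O, hO.preimage continuous_swap, ?_⟩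
    have : (fun z => (φ.toFun z).swap) '' A = Prod.swap ⁻¹' (φ.toFun '' A) := by
      rw [← image_swap_eq_preimage_swap, image_image]
    rw [this, h, preimage_inter]
    congr 1
    ext q
    simp [fiber, swap_mem_polydisc, mul_comm]

theorem CurveChart.swap_density {R₀ : ℝ} {t z : ℂ} (φ : CurveChart (fiber R₀ t))
    (hz : z ∈ φ.source) : φ.swap.density z = φ.density z := by
  have hd := (φ.differentiableOn.differentiableAt (φ.isOpen_source.mem_nhds hz)).hasDerivAt
  have h1 : HasDerivAt φ.swap.toFun (deriv φ.toFun z).swap z := hd.snd.prodMk hd.fst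
  unfold CurveChart.density
  rw [h1.deriv, add_comm]
  rfl

theorem measurableEmbedding_fiberChart (R₀ : ℝ) (t : ℂ) :
    MeasurableEmbedding (fiberChart R₀ t).toFun := by
  refine Measurable.measurableEmbedding (f := fun x : ℂ => (x, t / x)) ?_ ?_
  · exact measurable_id.prodMk (measurable_const.div measurable_id)
  · exact fun x y h => congrArg Prod.fst h

theorem measurableEmbedding_swap_fiberChart (R₀ : ℝ) (t : ℂ) :
    MeasurableEmbedding (fiberChart R₀ t).swap.toFun :=
  MeasurableEquiv.prodComm.measurableEmbedding.comp (measurableEmbedding_fiberChart R₀ t)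

theorem fiber_subset_image_fiberChart {R₀ : ℝ} {t : ℂ} {q : ℂ × ℂ} (hq : q ∈ fiber R₀ t)
    (h : q.1 ≠ 0) : q ∈ (fiberChart R₀ t).toFun '' (fiberChart R₀ t).source := by
  have : (q.1, t / q.1) = q := by
    rw [← hq.2]
    ext <;> simp [h]
  refine ⟨q.1, ⟨h, ?_⟩, this⟩
  rw [this]
  exact hq.1

theorem fiber_subset_image_swap_fiberChart {R₀ : ℝ} {t : ℂ} {q : ℂ × ℂ} (hq : q ∈ fiber R₀ t)
    (h : q.2 ≠ 0) : q ∈ (fiberChart R₀ t).swap.toFun '' (fiberChart R₀ t).swap.source := by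
  have hq' : q.swap ∈ fiber R₀ t := ⟨swap_mem_polydisc.2 hq.1, by rw [← hq.2]; simp [mul_comm]⟩
  obtain ⟨z, hz, h⟩ := fiber_subset_image_fiberChart hq' h
  exact ⟨z, hz, by change ((fiberChart R₀ t).toFun z).swap = q; rw [h, Prod.swap_swap]⟩

theorem lintegral_fiberChart_volume (R₀ : ℝ) (t : ℂ) {U : Set (ℂ × ℂ)} (hU : MeasurableSet U)
    (f : ℂ × ℂ → ℝ≥0∞) :
    ∫⁻ q in fiber R₀ t ∩ U, f q ∂(fiberChart R₀ t).volume =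
      ∫⁻ x in {x | x ≠ 0 ∧ (x, t / x) ∈ polydisc R₀ ∩ U},
        f (x, t / x) * (1 + ‖t / x ^ 2‖ₑ ^ 2) := by
  rw [CurveChart.lintegral_volume _ (measurableEmbedding_fiberChart R₀ t)]
  have h1 : (fiberChart R₀ t).source ∩ (fiberChart R₀ t).toFun ⁻¹' U =
      {x | x ≠ 0 ∧ (x, t / x) ∈ polydisc R₀ ∩ U} := by
    ext x
    exact and_assoc
  have h2 : MeasurableSet ((fiberChart R₀ t).source ∩ (fiberChart R₀ t).toFun ⁻¹' U) :=
    (fiberChart R₀ t).isOpen_source.measurableSet.inter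
      ((measurableEmbedding_fiberChart R₀ t).measurable hU)
  rw [← h1]
  refine setLIntegral_congr_fun h2 fun x hx => ?_
  rw [fiberChart_density hx.1.1]
  rfl

theorem lintegral_swap_fiberChart_volume (R₀ : ℝ) (t : ℂ) {U : Set (ℂ × ℂ)} (hU : MeasurableSet U)
    (f : ℂ × ℂ → ℝ≥0∞) :
    ∫⁻ q in fiber R₀ t ∩ U, f q ∂(fiberChart R₀ t).swap.volume =
      ∫⁻ y in {y | y ≠ 0 ∧ (t / y, y) ∈ polydisc R₀ ∩ U},
        f (t / y, y) * (1 + ‖t / y ^ 2‖ₑ ^ 2) := by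
  rw [CurveChart.lintegral_volume _ (measurableEmbedding_swap_fiberChart R₀ t)]
  have h1 : (fiberChart R₀ t).swap.source ∩ (fiberChart R₀ t).swap.toFun ⁻¹' U =
      {y | y ≠ 0 ∧ (t / y, y) ∈ polydisc R₀ ∩ U} := by
    ext y
    have : (y, t / y) ∈ polydisc R₀ ↔ (t / y, y) ∈ polydisc R₀ := and_comm
    constructor
    · exact fun h => ⟨h.1.1, this.1 h.1.2, h.2⟩
    · exact fun h => ⟨⟨h.1, this.2 h.2.1⟩, h.2.2⟩
  have h2 : MeasurableSet ((fiberChart R₀ t).swap.source ∩ (fiberChart R₀ t).swap.toFun ⁻¹' U) :=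
    (fiberChart R₀ t).isOpen_source.measurableSet.inter
      ((measurableEmbedding_swap_fiberChart R₀ t).measurable hU)
  rw [← h1]
  refine setLIntegral_congr_fun h2 fun x hx => ?_
  rw [CurveChart.swap_density (fiberChart R₀ t) hx.1, fiberChart_density hx.1.1]
  rfl

theorem curveVolume_fiber {R₀ : ℝ} {t : ℂ} (ht : t ≠ 0) :
    curveVolume (fiber R₀ t) = (fiberChart R₀ t).volume :=
  (fiberChart R₀ t).curveVolume_eq (ContinuousLinearMap.fst ℂ ℂ ℂ) (fun _ _ => rfl)
    fun _ hq => fiber_subset_image_fiberChart hq fun h => ht (by rw [← hq.2, h, zero_mul])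

theorem curveVolume_fiber_swap {R₀ : ℝ} {t : ℂ} (ht : t ≠ 0) :
    curveVolume (fiber R₀ t) = (fiberChart R₀ t).swap.volume :=
  (fiberChart R₀ t).swap.curveVolume_eq (ContinuousLinearMap.snd ℂ ℂ ℂ) (fun _ _ => rfl)
    fun _ hq => fiber_subset_image_swap_fiberChart hq fun h => ht (by rw [← hq.2, h, mul_zero])

/-- The fibre over `0` consists of the two punctured axes, which are disjoint charts, and the
origin, which carries no mass. -/
theorem curveVolume_fiber_zero (R₀ : ℝ) :
    curveVolume (fiber R₀ 0) = (fiberChart R₀ 0).volume + (fiberChart R₀ 0).swap.volume := by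
  set φ := fiberChart R₀ 0
  have hA : MeasurableSet {q : ℂ × ℂ | q.2 = 0} := (measurableSet_singleton 0).preimage measurable_snd
  refine le_antisymm (iSup_le fun ψ => Measure.le_iff.2 fun B hB => ?_)
    (Measure.le_iff.2 fun B hB => ?_)
  · rw [ψ.volume_apply hB, Measure.add_apply]
    have hcont := ψ.differentiableOn.continuousOn
    have ho1 : IsOpen (ψ.source ∩ ψ.toFun ⁻¹' {q | q.1 ≠ 0}) :=
      hcont.isOpen_inter_preimage ψ.isOpen_source (isOpen_ne_fun continuous_fst continuous_const)
    have ho2 : IsOpen (ψ.source ∩ ψ.toFun ⁻¹' {q | q.2 ≠ 0}) :=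
      hcont.isOpen_inter_preimage ψ.isOpen_source (isOpen_ne_fun continuous_snd continuous_const)
    have hnull : MeasureTheory.volume (ψ.source ∩ ψ.toFun ⁻¹' {0}) = 0 := by
      refine Set.Subsingleton.measure_zero (fun x hx y hy => ψ.injOn hx.1 hy.1 ?_) _
      exact (show ψ.toFun x = 0 from hx.2).trans (show ψ.toFun y = 0 from hy.2).symm
    have h1 := φ.lintegral_density_le ψ (ContinuousLinearMap.fst ℂ ℂ ℂ) (fun _ _ => rfl) ho1
      inter_subset_left (fun z hz => fiber_subset_image_fiberChart
        (ψ.mem_of_mem_source hz.1) hz.2) hB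
    have h2 := φ.swap.lintegral_density_le ψ (ContinuousLinearMap.snd ℂ ℂ ℂ) (fun _ _ => rfl) ho2
      inter_subset_left (fun z hz => fiber_subset_image_swap_fiberChart
        (ψ.mem_of_mem_source hz.1) hz.2) hB
    have hcov : ψ.toFun ⁻¹' B ∩ ψ.source ⊆
        (ψ.toFun ⁻¹' B ∩ (ψ.source ∩ ψ.toFun ⁻¹' {q | q.1 ≠ 0})) ∪
        (ψ.toFun ⁻¹' B ∩ (ψ.source ∩ ψ.toFun ⁻¹' {q | q.2 ≠ 0})) ∪
        (ψ.source ∩ ψ.toFun ⁻¹' {0}) := by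
      intro z hz
      by_cases h1 : (ψ.toFun z).1 = 0
      · by_cases h2 : (ψ.toFun z).2 = 0
        · exact Or.inr ⟨hz.2, Prod.ext h1 h2⟩
        · exact Or.inl (Or.inr ⟨hz.1, hz.2, h2⟩)
      · exact Or.inl (Or.inl ⟨hz.1, hz.2, h1⟩)
    refine (lintegral_mono_set hcov).trans ((lintegral_union_le _ _ _).trans ?_)
    rw [setLIntegral_measure_zero _ _ hnull, add_zero]
    exact (lintegral_union_le _ _ _).trans (add_le_add h1 h2)
  · have hx0 : φ.volume {q : ℂ × ℂ | q.2 = 0}ᶜ = 0 := by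
      rw [φ.volume_apply hA.compl]
      have : φ.toFun ⁻¹' {q : ℂ × ℂ | q.2 = 0}ᶜ = ∅ := by
        ext z
        simp [φ, fiberChart]
      simp [this]
    have hy0 : φ.swap.volume {q : ℂ × ℂ | q.2 = 0} = 0 := by
      rw [φ.swap.volume_apply hA]
      have : φ.swap.toFun ⁻¹' {q : ℂ × ℂ | q.2 = 0} ∩ φ.swap.source = ∅ := by
        ext z
        simp only [mem_inter_iff, mem_empty_iff_false, iff_false, not_and]
        exact fun h h' => h'.1 h
      rw [this, Measure.restrict_empty, lintegral_zero_measure]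
    have hle : ∀ ψ : CurveChart (fiber R₀ 0), ψ.volume ≤ curveVolume (fiber R₀ 0) :=
      fun ψ => le_iSup (fun ψ : CurveChart (fiber R₀ 0) => ψ.volume) ψ
    rw [Measure.add_apply, ← measure_inter_add_sdiff B hA (μ := φ.volume),
      ← measure_inter_add_sdiff B hA (μ := φ.swap.volume),
      ← measure_inter_add_sdiff B hA (μ := curveVolume (fiber R₀ 0)),
      measure_mono_null (sdiff_subset_compl B _) hx0, measure_mono_null inter_subset_right hy0,
      add_zero, zero_add]
    exact add_le_add (hle _ _) (hle _ _)

section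

variable {R₀ c : ℝ} {F : ℂ × ℂ → ℂ} {U : Set (ℂ × ℂ)}

theorem singularIntegral_fiber {t : ℂ} (ht : t ≠ 0) (hU : MeasurableSet U) :
    singularIntegral (fiber R₀ t) F c U =
      ∫⁻ x in {x | x ≠ 0 ∧ (x, t / x) ∈ polydisc R₀ ∩ U},
        ‖F (x, t / x)‖ₑ ^ (-2 * c) * (1 + ‖t / x ^ 2‖ₑ ^ 2) := by
  rw [singularIntegral, curveVolume_fiber ht, lintegral_fiberChart_volume R₀ t hU]

theorem singularIntegral_fiber_swap {t : ℂ} (ht : t ≠ 0) (hU : MeasurableSet U) :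
    singularIntegral (fiber R₀ t) F c U =
      ∫⁻ y in {y | y ≠ 0 ∧ (t / y, y) ∈ polydisc R₀ ∩ U},
        ‖F (t / y, y)‖ₑ ^ (-2 * c) * (1 + ‖t / y ^ 2‖ₑ ^ 2) := by
  rw [singularIntegral, curveVolume_fiber_swap ht, lintegral_swap_fiberChart_volume R₀ t hU]

theorem singularIntegral_fiber_zero (hU : MeasurableSet U) :
    singularIntegral (fiber R₀ 0) F c U =
      (∫⁻ x in {x | x ≠ 0 ∧ (x, 0) ∈ polydisc R₀ ∩ U}, ‖F (x, 0)‖ₑ ^ (-2 * c)) +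
        ∫⁻ y in {y | y ≠ 0 ∧ (0, y) ∈ polydisc R₀ ∩ U}, ‖F (0, y)‖ₑ ^ (-2 * c) := by
  rw [singularIntegral, curveVolume_fiber_zero, Measure.restrict_add, lintegral_add_measure,
    lintegral_fiberChart_volume R₀ 0 hU, lintegral_swap_fiberChart_volume R₀ 0 hU]
  simp

end

/-! ### Exponential sums attached to an antichain of exponents -/

/-- Power sums with at most `p + 1` distinct nodes determine their coefficients. -/
theorem eq_zero_of_forall_sum_mul_pow_eq_zero {ι : Type*} [Fintype ι] {T : Finset ι} {d l : ι → ℂ}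
    (hd : ∀ i ∉ T, d i = 0) (hl : InjOn l T) {p : ℕ} (hT : T.card ≤ p + 1)
    (h : ∀ k ≤ p, ∑ i, d i * l i ^ k = 0) (i : ι) : d i = 0 := by
  classical
  by_cases hi : i ∈ T
  swap
  · exact hd i hi
  set L : Polynomial ℂ := ∏ j ∈ T.erase i, (Polynomial.X - Polynomial.C (l j)) with hL
  have hdeg : L.natDegree < p + 1 := by
    rw [hL, Polynomial.natDegree_finsetProd_X_sub_C_eq_card, Finset.card_erase_of_mem hi]
    have := Finset.card_pos.2 ⟨i, hi⟩
    omega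
  have h1 : ∑ j, d j * L.eval (l j) = 0 := by
    simp_rw [Polynomial.eval_eq_sum_range' hdeg, Finset.mul_sum]
    rw [Finset.sum_comm]
    refine Finset.sum_eq_zero fun k hk => ?_
    have := h k (by simpa [Nat.lt_succ_iff] using hk)
    calc _ = L.coeff k * ∑ j, d j * l j ^ k := by
          rw [Finset.mul_sum]
          exact Finset.sum_congr rfl fun j _ => by ring
      _ = 0 := by rw [this, mul_zero]
  rw [Finset.sum_eq_single i] at h1
  · refine (mul_eq_zero.1 h1).resolve_right ?_
    rw [hL, Polynomial.eval_prod]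
    refine Finset.prod_ne_zero_iff.2 fun j hj => ?_
    have hj' := Finset.mem_erase.1 hj
    simpa [sub_eq_zero] using fun h => hj'.1 (hl hj'.2 hi h.symm)
  · intro j _ hji
    by_cases hj : j ∈ T
    · rw [hL, Polynomial.eval_prod,
        Finset.prod_eq_zero (Finset.mem_erase.2 ⟨hji, hj⟩) (by simp), mul_zero]
    · rw [hd j hj, zero_mul]
  · simp

/-- The derivatives at `w = 0` of order at most `p` of the exponential sum
`∑ cᵢ x^{aᵢ} y^{bᵢ} e^{(aᵢ - bᵢ) w}` are not all small compared to its terms, when `x` and `y` are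
small and all `aᵢ ≤ p`. Otherwise some limit of the normalized vectors of monomials would be a
nonzero vector with vanishing power sums. But one monomial divides another only if the latter is
negligible, so the support of the limit is an antichain; there, the exponents `aᵢ` are distinct and
the frequencies `aᵢ - bᵢ` too, and a Vandermonde argument gives a contradiction. -/
theorem exists_le_norm_sum_monomial {ι : Type*} [Fintype ι] [Nonempty ι] {a b : ι → ℕ} {c : ι → ℂ}
    (hab : Function.Injective fun i => (a i, b i)) (hc : ∀ i, c i ≠ 0) {p : ℕ}
    (ha : ∀ i, a i ≤ p) :
    ∃ δ > 0, ∀ x y : ℂ, x ≠ 0 → y ≠ 0 → ‖x‖ < δ → ‖y‖ < δ → ∃ k ≤ p, ∀ i,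
      δ * ‖x ^ a i * y ^ b i‖ ≤ ‖∑ j, c j * (x ^ a j * y ^ b j) * ((a j : ℂ) - b j) ^ k‖ := by
  by_contra! hcon
  choose x y hx0 hy0 hx hy hk using fun n : ℕ => hcon (1 / ((n : ℝ) + 1)) Nat.one_div_pos_of_nat
  choose! i hi using hk
  set X : ℕ → ι → ℂ := fun n j => x n ^ a j * y n ^ b j with hX
  have hX0 : ∀ n, 0 < ‖X n‖ := fun n => by
    refine norm_pos_iff.2 fun h => ?_
    have := congrFun h (Classical.arbitrary ι)
    simp [hX, hx0, hy0] at this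
  set Y : ℕ → ι → ℂ := fun n => ((‖X n‖⁻¹ : ℝ) : ℂ) • X n with hY
  have hYs : ∀ n, Y n ∈ Metric.sphere (0 : ι → ℂ) 1 := fun n => by
    rw [mem_sphere_zero_iff_norm, hY, norm_smul, Complex.norm_real, norm_inv, norm_norm,
      inv_mul_cancel₀ (hX0 n).ne']
  obtain ⟨z, hz, φ, hφ, hlim⟩ := (isCompact_sphere (0 : ι → ℂ) 1).tendsto_subseq hYs
  have hlimj : ∀ j, Tendsto (fun n => Y (φ n) j) atTop (𝓝 (z j)) := fun j =>
    ((continuous_apply j).tendsto _).comp hlim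
  have hone : Tendsto (fun n => 1 / ((φ n : ℝ) + 1)) atTop (𝓝 0) :=
    tendsto_one_div_add_atTop_nhds_zero_nat.comp hφ.tendsto_atTop
  have hYle : ∀ n j, ‖Y n j‖ ≤ 1 := fun n j =>
    (norm_le_pi_norm (Y n) j).trans (mem_sphere_zero_iff_norm.1 (hYs n)).le
  have hpow : ∀ k ≤ p, ∑ j, c j * z j * ((a j : ℂ) - b j) ^ k = 0 := by
    intro k hk
    have h1 : Tendsto (fun n => ∑ j, c j * Y (φ n) j * ((a j : ℂ) - b j) ^ k) atTop
        (𝓝 (∑ j, c j * z j * ((a j : ℂ) - b j) ^ k)) :=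
      tendsto_finsetSum _ fun j _ => ((hlimj j).const_mul _).mul_const _
    refine tendsto_nhds_unique h1 (squeeze_zero_norm (fun n => ?_) hone)
    have h2 : ∑ j, c j * Y (φ n) j * ((a j : ℂ) - b j) ^ k =
        ((‖X (φ n)‖⁻¹ : ℝ) : ℂ) * ∑ j, c j * X (φ n) j * ((a j : ℂ) - b j) ^ k := by
      rw [Finset.mul_sum]
      refine Finset.sum_congr rfl fun j _ => ?_
      simp only [hY, Pi.smul_apply, smul_eq_mul]
      ring
    rw [h2, norm_mul, Complex.norm_real, norm_inv, norm_norm, inv_mul_le_iff₀ (hX0 _)]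
    refine (hi (φ n) k hk).le.trans ?_
    rw [mul_comm]
    gcongr
    exact norm_le_pi_norm (X (φ n)) _
  have hanti : ∀ j l, j ≠ l → a j ≤ a l → b j ≤ b l → z l = 0 := by
    intro j l hjl h1 h2
    refine tendsto_nhds_unique (hlimj l) (squeeze_zero_norm (fun n => ?_) hone)
    have hε1 : 1 / ((φ n : ℝ) + 1) ≤ 1 := by
      rw [div_le_one (by positivity)]
      linarith [Nat.cast_nonneg (α := ℝ) (φ n)]
    have hstep : ‖x (φ n) ^ (a l - a j) * y (φ n) ^ (b l - b j)‖ ≤ 1 / ((φ n : ℝ) + 1) := by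
      rw [norm_mul, norm_pow, norm_pow]
      have hx' := (hx (φ n)).le
      have hy' := (hy (φ n)).le
      rcases Nat.eq_zero_or_pos (a l - a j) with h3 | h3
      · have h4 : b l - b j ≠ 0 := fun h4 => hjl (hab (Prod.ext (by simp; omega) (by simp; omega)))
        rw [h3, pow_zero, one_mul]
        exact (pow_le_of_le_one (norm_nonneg _) (hy'.trans hε1) h4).trans hy'
      · refine (mul_le_of_le_one_right (by positivity)
          (pow_le_one₀ (norm_nonneg _) (hy'.trans hε1))).trans ?_
        exact (pow_le_of_le_one (norm_nonneg _) (hx'.trans hε1) h3.ne').trans hx'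
    have h5 : Y (φ n) l = Y (φ n) j * (x (φ n) ^ (a l - a j) * y (φ n) ^ (b l - b j)) := by
      simp only [hY, hX, Pi.smul_apply, smul_eq_mul]
      rw [← Nat.sub_add_cancel h1, ← Nat.sub_add_cancel h2, pow_add, pow_add,
        Nat.add_sub_cancel, Nat.add_sub_cancel]
      ring
    rw [h5, norm_mul]
    exact (mul_le_of_le_one_left (norm_nonneg _) (hYle _ _)).trans hstep
  have hzero : ∀ j, c j * z j = 0 := by
    classical
    have hcmp : ∀ j l, z j ≠ 0 → z l ≠ 0 → j ≠ l → (a j ≤ a l ↔ ¬ b j ≤ b l) := by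
      intro j l hj hl hjl
      refine ⟨fun h1 h2 => hl (hanti j l hjl h1 h2), fun h1 => ?_⟩
      by_contra h2
      exact hj (hanti l j hjl.symm (not_le.1 h2).le (not_le.1 h1).le)
    refine eq_zero_of_forall_sum_mul_pow_eq_zero (T := Finset.univ.filter fun j => z j ≠ 0)
      (l := fun j => (a j : ℂ) - b j) ?_ ?_ ?_ hpow
    · intro j hj
      have : z j = 0 := by simpa using hj
      rw [this, mul_zero]
    · intro j hj l hl h
      by_contra hjl
      have h1 := hcmp j l (by simpa using hj) (by simpa using hl) hjl
      have h2 := hcmp l j (by simpa using hl) (by simpa using hj) (Ne.symm hjl)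
      have h' : (a j : ℂ) - b j = a l - b l := h
      have h3 : (a j : ℤ) - b j = a l - b l := by exact_mod_cast h'
      omega
    · have : Finset.card (Finset.univ.filter fun j => z j ≠ 0) ≤ (Finset.range (p + 1)).card := by
        refine Finset.card_le_card_of_injOn a (fun j _ => ?_) fun j hj l hl h => ?_
        · simpa [Nat.lt_succ_iff] using ha j
        · by_contra hjl
          have h1 := hcmp j l (by simpa using hj) (by simpa using hl) hjl
          have h2 := hcmp l j (by simpa using hl) (by simpa using hj) (Ne.symm hjl)
          omega
      simpa using this
  have : z = 0 := funext fun j => (mul_eq_zero.1 (hzero j)).resolve_left (hc j)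
  rw [this] at hz
  simp at hz

/-! ### The leading part of a function at the origin -/

/-- An approximation of `F` at the origin by the sum of the terms `c n x^n.1 y^n.2` of its power
series with `n` in a finite set `S` that meets the coordinate axes in exactly `(p, 0)` and `(0, q)`:
the error is small compared to `|x|^p + |y|^q`. So `p` and `q` are the orders of vanishing of
`F (x, 0)` and `F (0, y)`. -/
structure LeadingPart (F : ℂ × ℂ → ℂ) (p q : ℕ) where
  S : Finset (ℕ × ℕ)
  c : ℕ × ℕ → ℂ
  coeff_ne_zero : ∀ n ∈ S, c n ≠ 0
  le_left : ∀ n ∈ S, n.1 ≤ p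
  le_right : ∀ n ∈ S, n.2 ≤ q
  left_mem : (p, 0) ∈ S
  right_mem : (0, q) ∈ S
  eq_left : ∀ n ∈ S, n.2 = 0 → n.1 = p
  eq_right : ∀ n ∈ S, n.1 = 0 → n.2 = q
  approx : ∀ τ > 0, ∃ ρ > 0, ∀ x y : ℂ, ‖x‖ < ρ → ‖y‖ < ρ →
    ‖F (x, y) - ∑ n ∈ S, c n * (x ^ n.1 * y ^ n.2)‖ ≤ τ * (‖x‖ ^ p + ‖y‖ ^ q)

theorem nonempty_leadingPart {F : ℂ × ℂ → ℂ} {c : ℕ × ℕ → ℂ} {r : ℝ} (hr : 0 < r)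
    (hs : Summable fun n : ℕ × ℕ => ‖c n‖ * (r ^ n.1 * r ^ n.2))
    (hF : ∀ᶠ q : ℂ × ℂ in 𝓝 0, HasSum (fun n : ℕ × ℕ => c n * (q.1 ^ n.1 * q.2 ^ n.2)) (F q))
    {p q : ℕ} (hp : c (p, 0) ≠ 0) (hp' : ∀ a < p, c (a, 0) = 0) (hq : c (0, q) ≠ 0)
    (hq' : ∀ b < q, c (0, b) = 0) : Nonempty (LeadingPart F p q) := by
  classical
  set S : Finset (ℕ × ℕ) := (Finset.range (p + 1) ×ˢ Finset.range (q + 1)).filter fun n =>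
    c n ≠ 0 ∧ ((n.1 < p ∧ n.2 < q) ∨ n = (p, 0) ∨ n = (0, q)) with hS
  have hmem : ∀ n, n ∈ S ↔ c n ≠ 0 ∧ ((n.1 < p ∧ n.2 < q) ∨ n = (p, 0) ∨ n = (0, q)) := by
    intro n
    simp only [hS, Finset.mem_filter, Finset.mem_product, Finset.mem_range, and_iff_right_iff_imp]
    rintro ⟨-, h | rfl | rfl⟩ <;> (simp; try omega)
  have h00 : p = 0 ↔ q = 0 := by
    constructor
    · rintro rfl
      by_contra h
      exact hp (hq' 0 (Nat.pos_of_ne_zero h))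
    · rintro rfl
      by_contra h
      exact hq (hp' 0 (Nat.pos_of_ne_zero h))
  refine ⟨⟨S, c, fun n hn => ((hmem n).1 hn).1, ?_, ?_, (hmem _).2 ⟨hp, by simp⟩,
    (hmem _).2 ⟨hq, by simp⟩, ?_, ?_, ?_⟩⟩
  · intro n hn
    obtain ⟨-, h | rfl | rfl⟩ := (hmem n).1 hn
    exacts [h.1.le, le_rfl, Nat.zero_le _]
  · intro n hn
    obtain ⟨-, h | rfl | rfl⟩ := (hmem n).1 hn
    exacts [h.2.le, Nat.zero_le _, le_rfl]
  · rintro ⟨n1, n2⟩ hn (rfl : n2 = 0)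
    obtain ⟨h0, h | h | h⟩ := (hmem _).1 hn
    · exact absurd (hp' _ h.1) h0
    · exact congrArg Prod.fst h
    · have h1 : n1 = 0 := congrArg Prod.fst h
      have h2 : 0 = q := congrArg Prod.snd h
      exact h1.trans (h00.2 h2.symm).symm
  · rintro ⟨n1, n2⟩ hn (rfl : n1 = 0)
    obtain ⟨h0, h | h | h⟩ := (hmem _).1 hn
    · exact absurd (hq' _ h.2) h0
    · have h1 : n2 = 0 := congrArg Prod.snd h
      have h2 : 0 = p := congrArg Prod.fst h
      exact h1.trans (h00.1 h2.symm).symm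
    · exact congrArg Prod.snd h
  · intro τ hτ
    set A : ℝ := ∑' n : ℕ × ℕ, ‖c n‖ * (r ^ n.1 * r ^ n.2) with hA
    have hA0 : 0 ≤ A := tsum_nonneg fun n => by positivity
    set K : ℝ := (r ^ (p + 1))⁻¹ + (r ^ (q + 1))⁻¹ with hK
    have hK0 : 0 < K := by positivity
    obtain ⟨ρ₀, hρ₀, hball⟩ := Metric.eventually_nhds_iff.1 hF
    obtain ⟨ρ, hρ, hρm⟩ : ∃ ρ > 0, ρ ≤ ρ₀ ∧ ρ ≤ r ∧ ρ * (K * A) ≤ τ := by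
      refine ⟨min ρ₀ (min r (τ / (K * A + 1))), by positivity, min_le_left _ _,
        (min_le_right _ _).trans (min_le_left _ _), ?_⟩
      calc _ ≤ τ / (K * A + 1) * (K * A) := by
            gcongr
            exact (min_le_right _ _).trans (min_le_right _ _)
        _ ≤ τ := by
            rw [div_mul_eq_mul_div, div_le_iff₀ (by positivity)]
            nlinarith [mul_nonneg hK0.le hA0]
    obtain ⟨hρρ₀, hρr, hρτ⟩ := hρm
    refine ⟨ρ, hρ, fun x y hx hy => ?_⟩
    have hsum := hball (y := (x, y)) (by
      rw [dist_zero_right, Prod.norm_def]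
      exact max_lt (hx.trans_le hρρ₀) (hy.trans_le hρρ₀))
    have hsumS : HasSum (fun n : ℕ × ℕ => if n ∈ S then c n * (x ^ n.1 * y ^ n.2) else 0)
        (∑ n ∈ S, c n * (x ^ n.1 * y ^ n.2)) := by
      have := hasSum_sum_of_ne_finset_zero (s := S) (L := .unconditional _)
        (f := fun n : ℕ × ℕ => if n ∈ S then c n * (x ^ n.1 * y ^ n.2) else 0)
        (fun n hn => if_neg hn)
      rwa [Finset.sum_congr rfl fun n hn => if_pos hn] at this
    -- A monomial divisible by `x^p` and different from it is at most `ρ |x|^p` up to a constant.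
    have key : ∀ (u v : ℝ) (m k l : ℕ), 0 ≤ u → u ≤ ρ → 0 ≤ v → v ≤ ρ → m ≤ k → m + 1 ≤ k + l →
        u ^ k * v ^ l ≤ u ^ m * (ρ * ((r ^ (m + 1))⁻¹ * (r ^ k * r ^ l))) := by
      intro u v m k l hu huρ hv hvρ hmk hkl
      obtain ⟨j, rfl⟩ := Nat.exists_eq_add_of_le hmk
      obtain ⟨i, hi⟩ := Nat.exists_eq_add_of_le (show 1 ≤ j + l by omega)
      rw [pow_add, mul_assoc]
      refine mul_le_mul_of_nonneg_left ?_ (pow_nonneg hu m)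
      calc u ^ j * v ^ l ≤ ρ ^ j * ρ ^ l := by gcongr
        _ = ρ * ρ ^ i := by rw [← pow_add, hi, pow_add, pow_one]
        _ ≤ ρ * r ^ i := by gcongr
        _ = ρ * ((r ^ (m + 1))⁻¹ * (r ^ (m + j) * r ^ l)) := by
          rw [← pow_add, add_assoc, hi, ← add_assoc, pow_add r (m + 1) i,
            inv_mul_cancel_left₀ (by positivity)]
    refine ((hsum.sub hsumS).norm_le_of_bounded
      (hs.hasSum.mul_left (ρ * (K * (‖x‖ ^ p + ‖y‖ ^ q)))) fun n => ?_).trans ?_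
    · by_cases hn : n ∈ S
      · simp only [hn, if_true, sub_self, norm_zero]
        positivity
      simp only [hn, if_false, sub_zero]
      by_cases hcn : c n = 0
      · simp [hcn]
      have hn' : ¬ ((n.1 < p ∧ n.2 < q) ∨ n = (p, 0) ∨ n = (0, q)) := fun h =>
        hn ((hmem n).2 ⟨hcn, h⟩)
      push Not at hn'
      rw [norm_mul, norm_mul, norm_pow, norm_pow]
      have hcase : ‖x‖ ^ n.1 * ‖y‖ ^ n.2 ≤
          ρ * (K * (‖x‖ ^ p + ‖y‖ ^ q)) * (r ^ n.1 * r ^ n.2) := by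
        by_cases h1 : p ≤ n.1
        · have h2 : p + 1 ≤ n.1 + n.2 := by
            by_contra h
            exact hn'.2.1 (Prod.ext (by simp; omega) (by simp; omega))
          refine (key ‖x‖ ‖y‖ p n.1 n.2 (norm_nonneg _) hx.le (norm_nonneg _) hy.le h1 h2).trans ?_
          calc _ = ρ * ((r ^ (p + 1))⁻¹ * ‖x‖ ^ p) * (r ^ n.1 * r ^ n.2) := by ring
            _ ≤ _ := by
              gcongr
              · exact le_add_of_nonneg_right (by positivity)
              · exact le_add_of_nonneg_right (by positivity)
        · have h1' : q ≤ n.2 := hn'.1 (not_le.1 h1)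
          have h2 : q + 1 ≤ n.2 + n.1 := by
            by_contra h
            exact hn'.2.2 (Prod.ext (by simp; omega) (by simp; omega))
          rw [mul_comm]
          refine (key ‖y‖ ‖x‖ q n.2 n.1 (norm_nonneg _) hy.le (norm_nonneg _) hx.le h1' h2).trans ?_
          calc _ = ρ * ((r ^ (q + 1))⁻¹ * ‖y‖ ^ q) * (r ^ n.1 * r ^ n.2) := by ring
            _ ≤ _ := by
              gcongr
              · exact le_add_of_nonneg_left (by positivity)
              · exact le_add_of_nonneg_left (by positivity)
      calc _ ≤ ‖c n‖ * (ρ * (K * (‖x‖ ^ p + ‖y‖ ^ q)) * (r ^ n.1 * r ^ n.2)) := by gcongr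
        _ = _ := by ring
    · calc _ = ρ * (K * A) * (‖x‖ ^ p + ‖y‖ ^ q) := by ring
        _ ≤ _ := by gcongr

namespace LeadingPart

variable {F : ℂ × ℂ → ℂ} {p q : ℕ}

/-- The leading part after the exchange of the coordinates. -/
def swap (L : LeadingPart F p q) : LeadingPart (fun z => F z.swap) q p where
  S := L.S.map (Equiv.prodComm ℕ ℕ).toEmbedding
  c n := L.c n.swap
  coeff_ne_zero n hn := L.coeff_ne_zero _ (by
    obtain ⟨m, hm, rfl⟩ := Finset.mem_map.1 hn
    exact hm)
  le_left n hn := by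
    obtain ⟨m, hm, rfl⟩ := Finset.mem_map.1 hn
    exact L.le_right m hm
  le_right n hn := by
    obtain ⟨m, hm, rfl⟩ := Finset.mem_map.1 hn
    exact L.le_left m hm
  left_mem := Finset.mem_map.2 ⟨(0, q), L.right_mem, rfl⟩
  right_mem := Finset.mem_map.2 ⟨(p, 0), L.left_mem, rfl⟩
  eq_left n hn h := by
    obtain ⟨m, hm, rfl⟩ := Finset.mem_map.1 hn
    exact L.eq_right m hm h
  eq_right n hn h := by
    obtain ⟨m, hm, rfl⟩ := Finset.mem_map.1 hn
    exact L.eq_left m hm h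
  approx τ hτ := by
    obtain ⟨ρ, hρ, h⟩ := L.approx τ hτ
    refine ⟨ρ, hρ, fun x y hx hy => ?_⟩
    rw [add_comm, Finset.sum_map]
    have e : ∀ n : ℕ × ℕ, L.c n.swap.swap * (x ^ n.2 * y ^ n.1) = L.c n * (y ^ n.1 * x ^ n.2) :=
      fun n => by rw [Prod.swap_swap, mul_comm (x ^ n.2)]
    exact (Finset.sum_congr rfl fun n _ => e n) ▸ h y x hy hx

theorem exists_norm_axis_bounds (L : LeadingPart F p q) :
    ∃ ρ > 0, ∃ A > 0, ∃ B > 0, ∀ x : ℂ, ‖x‖ < ρ →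
      A * ‖x‖ ^ p ≤ ‖F (x, 0)‖ ∧ ‖F (x, 0)‖ ≤ B * ‖x‖ ^ p := by
  have hc : 0 < ‖L.c (p, 0)‖ := norm_pos_iff.2 (L.coeff_ne_zero _ L.left_mem)
  obtain ⟨ρ, hρ, h⟩ := L.approx (‖L.c (p, 0)‖ / 4) (by positivity)
  refine ⟨ρ, hρ, ‖L.c (p, 0)‖ / 2, by positivity, 2 * ‖L.c (p, 0)‖, by positivity, fun x hx => ?_⟩
  have h1 := h x 0 hx (by simpa using hρ)
  have h2 : ∑ n ∈ L.S, L.c n * (x ^ n.1 * (0 : ℂ) ^ n.2) = L.c (p, 0) * x ^ p := by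
    rw [Finset.sum_eq_single (p, 0)]
    · simp
    · intro n hn hne
      have : n.2 ≠ 0 := fun h => hne (Prod.ext (L.eq_left n hn h) h)
      simp [this]
    · exact fun h => absurd L.left_mem h
  have h3 : ‖(0 : ℂ)‖ ^ q ≤ ‖x‖ ^ p := by
    rcases Nat.eq_zero_or_pos q with rfl | hq
    · have : 0 = p := L.eq_left _ L.right_mem rfl
      simp [← this]
    · rw [norm_zero, zero_pow hq.ne']
      positivity
  rw [h2] at h1
  have h4 : ‖F (x, 0) - L.c (p, 0) * x ^ p‖ ≤ ‖L.c (p, 0)‖ / 2 * ‖x‖ ^ p := by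
    refine h1.trans ?_
    nlinarith
  have h5 : ‖L.c (p, 0) * x ^ p‖ = ‖L.c (p, 0)‖ * ‖x‖ ^ p := by rw [norm_mul, norm_pow]
  constructor
  · have := norm_sub_norm_le (L.c (p, 0) * x ^ p) (F (x, 0))
    rw [norm_sub_rev] at this
    linarith
  · have := norm_sub_norm_le (F (x, 0)) (L.c (p, 0) * x ^ p)
    nlinarith [pow_nonneg (norm_nonneg x) p]

end LeadingPart

/-! ### The integral along a piece of an orbit of `(x, y) ↦ (x e^w, y e^{-w})` -/

theorem iteratedDeriv_sum_mul_exp {ι : Type*} (s : Finset ι) (A l : ι → ℂ) (k : ℕ) (w : ℂ) :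
    iteratedDeriv k (fun w => ∑ i ∈ s, A i * Complex.exp (l i * w)) w =
      ∑ i ∈ s, A i * l i ^ k * Complex.exp (l i * w) := by
  rw [iteratedDeriv_fun_sum (fun i _ => ContDiff.contDiffAt (by fun_prop))]
  refine Finset.sum_congr rfl fun i _ => ?_
  rw [iteratedDeriv_const_mul_field, iteratedDeriv_cexp_const_mul, mul_assoc]

theorem norm_exp_le_three {w : ℂ} (hw : ‖w‖ ≤ 1) : ‖Complex.exp w‖ ≤ 3 :=
  (Complex.norm_exp_le_exp_norm w).trans
    ((Real.exp_le_exp.2 hw).trans (by linarith [Real.exp_one_lt_d9]))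

/-- Uniform integrability of `|F|^{-2c}` along orbits through points `(x, y)` near the origin. The
restriction of `F` to the orbit is an exponential sum up to a small error, so one of its derivatives
of order at most `p` is as large as `|x|^p` and `|y|^q`. -/
theorem LeadingPart.exists_lintegral_orbit_le {F : ℂ × ℂ → ℂ} {p q : ℕ} (L : LeadingPart F p q)
    {R₀ : ℝ} (hR₀ : 0 < R₀) (hF : DifferentiableOn ℂ F (polydisc R₀)) {c : ℝ} (hc : 0 < c)
    (hpc : p * c < 1) :
    ∃ r > 0, r ≤ 1 ∧ ∃ κ > 0, ∃ C : ℝ≥0, ∀ x y : ℂ, x ≠ 0 → y ≠ 0 → ‖x‖ < κ → ‖y‖ < κ →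
      ∫⁻ w in Metric.closedBall (0 : ℂ) r, ‖F (x * Complex.exp w, y * Complex.exp (-w))‖ₑ ^ (-2 * c)
        ≤ C * ENNReal.ofReal (max (‖x‖ ^ p) (‖y‖ ^ q) ^ (-2 * c)) := by
  have hne : Nonempty L.S := ⟨⟨(p, 0), L.left_mem⟩⟩
  obtain ⟨δ, hδ, hlow⟩ := exists_le_norm_sum_monomial (ι := L.S) (a := fun n => n.1.1)
    (b := fun n => n.1.2) (c := fun n => L.c n) (fun n m h => Subtype.ext h)
    (fun n => L.coeff_ne_zero n n.2) (p := p) (fun n => L.le_left n n.2)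
  set l : L.S → ℂ := fun n => (n.1.1 : ℂ) - n.1.2 with hl
  -- The derivatives of the exponential sum vary little on a small disc.
  have hcont : ∀ k, ∀ᶠ w : ℂ in 𝓝 0,
      ∑ n : L.S, ‖L.c n‖ * ‖l n‖ ^ k * ‖Complex.exp (l n * w) - 1‖ < δ / 4 := by
    intro k
    have h1 : Continuous fun w : ℂ =>
        ∑ n : L.S, ‖L.c n‖ * ‖l n‖ ^ k * ‖Complex.exp (l n * w) - 1‖ := by fun_prop
    have h2 := h1.tendsto 0
    simp only [mul_zero, Complex.exp_zero, sub_self, norm_zero, Finset.sum_const_zero] at h2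
    exact h2.eventually (gt_mem_nhds (by positivity))
  have hcont' : ∀ᶠ w : ℂ in 𝓝 0, ∀ k ∈ Finset.range (p + 1),
      ∑ n : L.S, ‖L.c n‖ * ‖l n‖ ^ k * ‖Complex.exp (l n * w) - 1‖ < δ / 4 :=
    (Finset.eventually_all _).2 fun k _ => hcont k
  obtain ⟨r₁, hr₁, hsmall⟩ := Metric.eventually_nhds_iff.1 hcont'
  set r := min (r₁ / 2) (1 / 4) with hr
  have hr0 : 0 < r := by positivity
  have hr4 : r ≤ 1 / 4 := min_le_right _ _
  choose! C hC using fun (k : ℕ) (hk : k ≤ p) => exists_lintegral_rpow_neg_le hr0 hc k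
    (lt_of_le_of_lt (mul_le_mul_of_nonneg_right (Nat.cast_le.2 hk) hc.le) hpc)
  set B : ℝ := (3 ^ p + 3 ^ q) * (p.factorial * 2 ^ p) with hB
  have hB0 : 0 < B := by positivity
  obtain ⟨ρ, hρ, happ⟩ := L.approx (δ / 4 / B) (by positivity)
  -- The coordinates change by a factor of at most `3` along the orbit, which has to stay in the
  -- polydisc of radius `R₀` and in that of radius `ρ`.
  set κ := min δ (min (ρ / 3) (R₀ / 3)) with hκ
  have hκ0 : 0 < κ := by positivity
  have hκρ : 3 * κ ≤ ρ := by
    have : κ ≤ ρ / 3 := (min_le_right _ _).trans (min_le_left _ _)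
    linarith
  have hκR : 3 * κ ≤ R₀ := by
    have : κ ≤ R₀ / 3 := (min_le_right _ _).trans (min_le_right _ _)
    linarith
  refine ⟨r, hr0, by linarith, κ, hκ0, (∑ k ∈ Finset.range (p + 1), C k) *
    (δ ^ (-2 * c)).toNNReal, fun x y hx0 hy0 hx hy => ?_⟩
  set X : L.S → ℂ := fun n => x ^ n.1.1 * y ^ n.1.2 with hX
  set N : ℝ := ‖X‖ with hN
  have hxN : ‖x‖ ^ p ≤ N := by
    have := norm_le_pi_norm X ⟨(p, 0), L.left_mem⟩
    simpa [hX] using this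
  have hyN : ‖y‖ ^ q ≤ N := by
    have := norm_le_pi_norm X ⟨(0, q), L.right_mem⟩
    simpa [hX] using this
  have hm0 : 0 < max (‖x‖ ^ p) (‖y‖ ^ q) :=
    lt_max_of_lt_left (pow_pos (norm_pos_iff.2 hx0) p)
  have hmN : max (‖x‖ ^ p) (‖y‖ ^ q) ≤ N := max_le hxN hyN
  have hN0 : 0 < N := hm0.trans_le hmN
  obtain ⟨k, hkp, hk⟩ := hlow x y hx0 hy0 (hx.trans_le (min_le_left _ _))
    (hy.trans_le (min_le_left _ _))
  set a : ℂ := ∑ n : L.S, L.c n * X n * l n ^ k with ha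
  have haN : δ * N ≤ ‖a‖ := by
    have h1 : N ≤ ‖a‖ / δ := (pi_norm_le_iff_of_nonneg (by positivity)).2 fun n => by
      rw [le_div_iff₀ hδ, mul_comm]
      exact hk n
    rwa [le_div_iff₀ hδ, mul_comm] at h1
  have ha0 : a ≠ 0 := norm_pos_iff.1 (lt_of_lt_of_le (by positivity) haN)
  set G : ℂ → ℂ := fun w => ∑ n : L.S, L.c n * X n * Complex.exp (l n * w) with hG
  set h : ℂ → ℂ := fun w => F (x * Complex.exp w, y * Complex.exp (-w)) with hh
  have hGd : Differentiable ℂ G := by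
    simp only [hG]
    fun_prop
  have hbd : ∀ w ∈ Metric.ball (0 : ℂ) 1, ‖x * Complex.exp w‖ < 3 * κ ∧
      ‖y * Complex.exp (-w)‖ < 3 * κ := by
    intro w hw
    rw [mem_ball_zero_iff] at hw
    have h1 := norm_exp_le_three hw.le
    have h2 := norm_exp_le_three (w := -w) (by rw [norm_neg]; exact hw.le)
    rw [norm_mul, norm_mul]
    constructor <;> nlinarith [norm_nonneg x, norm_nonneg y]
  have hhd : DifferentiableOn ℂ h (Metric.ball 0 1) := by
    refine hF.comp (t := polydisc R₀)
      (f := fun w : ℂ => (x * Complex.exp w, y * Complex.exp (-w))) ?_ fun w hw => ?_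
    · exact Differentiable.differentiableOn (by fun_prop)
    · exact ⟨(hbd w hw).1.trans_le hκR, (hbd w hw).2.trans_le hκR⟩
  have hE : ∀ w ∈ Metric.ball (0 : ℂ) 1,
      ‖h w - G w‖ ≤ δ / 4 / B * ((3 ^ p + 3 ^ q) * N) := by
    intro w hw
    have h1 := happ (x * Complex.exp w) (y * Complex.exp (-w)) ((hbd w hw).1.trans_le hκρ)
      ((hbd w hw).2.trans_le hκρ)
    have h2 : ∑ n ∈ L.S, L.c n * ((x * Complex.exp w) ^ n.1 * (y * Complex.exp (-w)) ^ n.2) =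
        G w := by
      rw [← Finset.sum_coe_sort]
      refine Finset.sum_congr rfl fun n _ => ?_
      simp only [hX, hl, mul_pow, ← Complex.exp_nat_mul]
      rw [sub_mul, sub_eq_add_neg, Complex.exp_add]
      ring_nf
    rw [h2] at h1
    refine h1.trans ?_
    rw [mem_ball_zero_iff] at hw
    have h3 := norm_exp_le_three hw.le
    have h4 := norm_exp_le_three (w := -w) (by rw [norm_neg]; exact hw.le)
    rw [norm_mul, norm_mul, mul_pow, mul_pow]
    gcongr
    calc _ ≤ N * 3 ^ p + N * 3 ^ q := by gcongr
      _ = _ := by ring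
  have hder : ∀ w ∈ Metric.closedBall (0 : ℂ) r, ‖iteratedDeriv k h w - a‖ ≤ ‖a‖ / 2 := by
    intro w hw
    rw [mem_closedBall_zero_iff] at hw
    have hw1 : w ∈ Metric.ball (0 : ℂ) 1 := by
      rw [mem_ball_zero_iff]; linarith
    have hw2 : Metric.closedBall w (1 / 2) ⊆ Metric.ball 0 1 := by
      refine Metric.closedBall_subset_ball' ?_
      rw [dist_zero_right]; linarith
    have h1 : ‖iteratedDeriv k (h - G) w‖ ≤ δ / 4 * N := by
      have hd : DiffContOnCl ℂ (h - G) (Metric.ball w (1 / 2)) :=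
        (DifferentiableOn.mono (hhd.sub hGd.differentiableOn) hw2).diffContOnCl_ball subset_rfl
      refine (Complex.norm_iteratedDeriv_le_of_forall_mem_sphere_norm_le k (by norm_num) hd
        (fun z hz => hE z (hw2 (Metric.sphere_subset_closedBall hz)))).trans ?_
      have h2 : (k.factorial : ℝ) * 2 ^ k ≤ p.factorial * 2 ^ p := by
        gcongr
        norm_num
      calc _ = δ / 4 / B * ((3 ^ p + 3 ^ q) * (k.factorial * 2 ^ k)) * N := by
            rw [one_div, inv_pow, div_inv_eq_mul]
            ring
        _ ≤ δ / 4 / B * B * N := by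
            rw [hB]
            gcongr
        _ = δ / 4 * N := by rw [div_mul_cancel₀ _ hB0.ne']
    have h2 : ‖iteratedDeriv k G w - a‖ ≤ δ / 4 * N := by
      rw [hG, iteratedDeriv_sum_mul_exp, ha, ← Finset.sum_sub_distrib]
      have h3 := hsmall (y := w) (by
        rw [dist_zero_right]
        have : r ≤ r₁ / 2 := min_le_left _ _
        linarith) k (Finset.mem_range.2 (Nat.lt_succ_of_le hkp))
      calc _ ≤ ∑ n : L.S, N * (‖L.c n‖ * ‖l n‖ ^ k * ‖Complex.exp (l n * w) - 1‖) := by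
            refine norm_sum_le_of_le _ fun n _ => ?_
            have : L.c n * X n * l n ^ k * Complex.exp (l n * w) - L.c n * X n * l n ^ k =
                X n * (L.c n * l n ^ k * (Complex.exp (l n * w) - 1)) := by ring
            rw [this, norm_mul (X n), norm_mul (_ * _), norm_mul (L.c n), norm_pow]
            exact mul_le_mul_of_nonneg_right (norm_le_pi_norm X n) (by positivity)
        _ ≤ _ := by
            rw [← Finset.mul_sum, mul_comm]
            gcongr
    have h3 : iteratedDeriv k h w = iteratedDeriv k (h - G) w + iteratedDeriv k G w := by
      have hha : ContDiffAt ℂ k h w :=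
        (hhd.analyticAt (Metric.isOpen_ball.mem_nhds hw1)).contDiffAt
      rw [iteratedDeriv_sub hha hGd.contDiff.contDiffAt, sub_add_cancel]
    rw [h3, add_sub_assoc]
    refine (norm_add_le _ _).trans ?_
    linarith
  have hfin := hC k hkp (Metric.ball 0 1) h a Metric.isOpen_ball
    (Metric.closedBall_subset_ball (by linarith)) hhd hder
  refine hfin.trans ?_
  have hneg : -2 * c ≤ 0 := by linarith
  have h5 : ‖a‖ₑ ^ (-2 * c) ≤ ENNReal.ofReal (δ ^ (-2 * c)) *
      ENNReal.ofReal (max (‖x‖ ^ p) (‖y‖ ^ q) ^ (-2 * c)) := by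
    rw [enorm_rpow_eq_ofReal ha0, ← ENNReal.ofReal_mul (by positivity),
      ← Real.mul_rpow hδ.le hm0.le]
    refine ENNReal.ofReal_le_ofReal (Real.rpow_le_rpow_of_nonpos (by positivity) ?_ hneg)
    exact (mul_le_mul_of_nonneg_left hmN hδ.le).trans haN
  have h6 : C k ≤ ∑ k ∈ Finset.range (p + 1), C k :=
    Finset.single_le_sum (f := C) (fun _ _ => zero_le) (Finset.mem_range.2 (Nat.lt_succ_of_le hkp))
  rw [ENNReal.coe_mul, mul_assoc]
  refine mul_le_mul' (ENNReal.coe_le_coe.2 h6) ?_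
  exact h5

/-! ### Uniform smallness of the integrals near the origin -/

theorem lintegral_eq_lintegral_comp_mul (f : ℂ → ℝ≥0∞) {a : ℂ} (ha : a ≠ 0) :
    ∫⁻ x, f x = ∫⁻ x, ‖a‖ₑ ^ 2 * f (x * a) := by
  have h := lintegral_image_eq_lintegral_enorm_deriv_sq_mul (g := fun x : ℂ => x * a)
    MeasurableSet.univ (fun z _ => differentiableAt_id.mul_const a)
    (mul_left_injective₀ ha).injOn f
  have hsurj : Function.Surjective fun x : ℂ => x * a := fun y => ⟨y / a, div_mul_cancel₀ y ha⟩
  rw [image_univ, hsurj.range_eq, Measure.restrict_univ] at h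
  rw [h]
  refine lintegral_congr fun x => ?_
  have : deriv (fun x : ℂ => x * a) x = a := by simp
  rw [this]

/-- The integral of a function as an average of its integrals over the pieces `x e^w`, `|w| ≤ r`,
of orbits of the multiplicative group. -/
theorem volume_mul_lintegral_eq (r : ℝ) {g : ℂ → ℝ≥0∞} (hg : Measurable g) :
    volume (Metric.closedBall (0 : ℂ) r) * ∫⁻ x, g x =
      ∫⁻ x, ∫⁻ w in Metric.closedBall (0 : ℂ) r,
        ‖Complex.exp w‖ₑ ^ 2 * g (x * Complex.exp w) := by
  rw [lintegral_lintegral_swap]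
  · simp_rw [← lintegral_eq_lintegral_comp_mul g (Complex.exp_ne_zero _)]
    rw [setLIntegral_const, mul_comm]
  · refine Measurable.aemeasurable ?_
    have : Measurable Complex.exp := Complex.measurable_exp
    fun_prop

/-- The integrals of `|F|^{-2c}` over the parts of the fibres over `t ≠ 0` in a small polydisc are
small uniformly in `t`. -/
theorem LeadingPart.exists_lintegral_polydisc_le {F : ℂ × ℂ → ℂ} {p q : ℕ} (L : LeadingPart F p q)
    {R₀ : ℝ} (hR₀ : 0 < R₀) (hF : DifferentiableOn ℂ F (polydisc R₀)) (hFm : Measurable F) {c : ℝ}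
    (hc : 0 < c) (hpc : p * c < 1) (hqc : q * c < 1) :
    ∃ B : ℝ → ℝ≥0∞, Tendsto B (𝓝[>] 0) (𝓝 0) ∧ ∃ ε₀ > 0, ∀ ε, 0 < ε → ε < ε₀ → ∀ t : ℂ, t ≠ 0 →
      ∫⁻ x in {x | x ≠ 0 ∧ (x, t / x) ∈ polydisc ε},
        ‖F (x, t / x)‖ₑ ^ (-2 * c) * (1 + ‖t / x ^ 2‖ₑ ^ 2) ≤ B ε := by
  obtain ⟨r, hr, hr1, κ, hκ, C, hC⟩ := L.exists_lintegral_orbit_le hR₀ hF hc hpc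
  set V := volume (Metric.closedBall (0 : ℂ) r) with hV
  have hV0 : V ≠ 0 := (Metric.measure_closedBall_pos volume 0 hr).ne'
  have hVtop : V ≠ ∞ := measure_closedBall_lt_top.ne
  set I : ℝ → ℝ≥0∞ := fun ε =>
    ENNReal.ofReal (2 * Real.pi * ((3 * ε) ^ (-2 * c * p + 2) / (-2 * c * p + 2))) +
    ENNReal.ofReal (2 * Real.pi * ((3 * ε) ^ (-2 * c * q + 2) / (-2 * c * q + 2))) with hI
  have hp2 : 0 < -2 * c * p + 2 := by nlinarith
  have hq2 : 0 < -2 * c * q + 2 := by nlinarith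
  refine ⟨fun ε => V⁻¹ * (729 * C * I ε), ?_, κ / 3, by positivity, fun ε hε hεκ t ht => ?_⟩
  · have h1 : ∀ s : ℝ, 0 < s → Tendsto (fun ε : ℝ =>
        ENNReal.ofReal (2 * Real.pi * ((3 * ε) ^ s / s))) (𝓝[>] 0) (𝓝 0) := by
      intro s hs
      have h2 : Continuous fun ε : ℝ => ENNReal.ofReal (2 * Real.pi * ((3 * ε) ^ s / s)) := by
        refine ENNReal.continuous_ofReal.comp (continuous_const.mul (Continuous.div_const ?_ s))
        exact (Real.continuous_rpow_const hs.le).comp (continuous_const.mul continuous_id)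
      have h3 := h2.tendsto 0
      simp only [mul_zero, Real.zero_rpow hs.ne', zero_div, ENNReal.ofReal_zero] at h3
      exact h3.mono_left nhdsWithin_le_nhds
    have h4 : Tendsto I (𝓝[>] 0) (𝓝 0) := by
      have := (h1 _ hp2).add (h1 _ hq2)
      rwa [add_zero] at this
    have hCtop : (729 * C : ℝ≥0∞) ≠ ∞ := ENNReal.mul_ne_top (by simp) ENNReal.coe_ne_top
    have h5 := ENNReal.Tendsto.const_mul (a := V⁻¹)
      (ENNReal.Tendsto.const_mul (a := 729 * C) h4 (Or.inr hCtop))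
      (Or.inr (ENNReal.inv_ne_top.2 hV0))
    simpa using h5
  set Z : Set ℂ := {x | x ≠ 0 ∧ (x, t / x) ∈ polydisc ε} with hZ
  set Z' : Set ℂ := {x | x ≠ 0 ∧ (x, t / x) ∈ polydisc (3 * ε)} with hZ'
  have hdiv : Measurable fun x : ℂ => t / x := measurable_const.div measurable_id
  have hmeas : ∀ ε, MeasurableSet {x : ℂ | x ≠ 0 ∧ (x, t / x) ∈ polydisc ε} := fun ε =>
    (measurableSet_singleton (0 : ℂ)).compl.inter
      ((measurable_id.prodMk hdiv) (isOpen_polydisc ε).measurableSet)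
  set f : ℂ → ℝ≥0∞ := fun x => ‖F (x, t / x)‖ₑ ^ (-2 * c) * (1 + ‖t / x ^ 2‖ₑ ^ 2) with hf
  have hfm : Measurable f := by
    have h1 : Measurable fun x => F (x, t / x) := hFm.comp (measurable_id.prodMk hdiv)
    have h2 : Measurable fun x : ℂ => t / x ^ 2 := measurable_const.div (measurable_id.pow_const 2)
    fun_prop
  set M : ℂ → ℝ≥0∞ := fun x =>
    ENNReal.ofReal (max (‖x‖ ^ p) (‖t / x‖ ^ q) ^ (-2 * c)) * (1 + ‖t / x ^ 2‖ₑ ^ 2) with hM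
  -- Since `|e^w| ≤ 3` and `|e^{-w}| ≤ 3`, along the orbit of `x` the Jacobian is at most `9` and the
  -- density of the volume form changes by a factor of at most `81`, whence the constant `729`.
  have horbit : ∀ x, ∫⁻ w in Metric.closedBall (0 : ℂ) r,
      ‖Complex.exp w‖ₑ ^ 2 * Z.indicator f (x * Complex.exp w) ≤
      Z'.indicator (fun x => 729 * C * M x) x := by
    intro x
    have hexp : ∀ w ∈ Metric.closedBall (0 : ℂ) r, ‖Complex.exp w‖ ≤ 3 ∧
        ‖Complex.exp (-w)‖ ≤ 3 := by
      intro w hw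
      rw [mem_closedBall_zero_iff] at hw
      exact ⟨norm_exp_le_three (hw.trans hr1),
        norm_exp_le_three (by rw [norm_neg]; exact hw.trans hr1)⟩
    have hdivexp : ∀ w, t / (x * Complex.exp w) = t / x * Complex.exp (-w) := fun w => by
      rw [Complex.exp_neg, div_mul_eq_div_div, div_eq_mul_inv]
    by_cases hx : x ∈ Z'
    · rw [indicator_of_mem hx]
      have hpt : ∀ w ∈ Metric.closedBall (0 : ℂ) r,
          ‖Complex.exp w‖ₑ ^ 2 * Z.indicator f (x * Complex.exp w) ≤
          729 * (1 + ‖t / x ^ 2‖ₑ ^ 2) *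
            ‖F (x * Complex.exp w, t / x * Complex.exp (-w))‖ₑ ^ (-2 * c) := by
        intro w hw
        have h3 : ‖Complex.exp w‖ₑ ≤ 3 := by
          rw [← ofReal_norm]
          exact ENNReal.ofReal_le_of_le_toReal (by simpa using (hexp w hw).1)
        have h3' : ‖Complex.exp (-w)‖ₑ ≤ 3 := by
          rw [← ofReal_norm]
          exact ENNReal.ofReal_le_of_le_toReal (by simpa using (hexp w hw).2)
        have h4 : t / (x * Complex.exp w) ^ 2 = t / x ^ 2 * Complex.exp (-w) ^ 2 := by
          rw [Complex.exp_neg, mul_pow, div_mul_eq_div_div, div_eq_mul_inv _ (Complex.exp w ^ 2),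
            inv_pow]
        calc _ ≤ ‖Complex.exp w‖ₑ ^ 2 * f (x * Complex.exp w) := by
              gcongr
              exact indicator_le_self _ _ _
          _ = ‖Complex.exp w‖ₑ ^ 2 *
              (‖F (x * Complex.exp w, t / x * Complex.exp (-w))‖ₑ ^ (-2 * c) *
                (1 + (‖t / x ^ 2‖ₑ * ‖Complex.exp (-w)‖ₑ ^ 2) ^ 2)) := by
              simp only [hf]
              rw [hdivexp, h4, enorm_mul, enorm_pow]
          _ ≤ 3 ^ 2 * (‖F (x * Complex.exp w, t / x * Complex.exp (-w))‖ₑ ^ (-2 * c) *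
                (81 * 1 + (‖t / x ^ 2‖ₑ * 3 ^ 2) ^ 2)) := by
              gcongr
              norm_num
          _ = _ := by ring
      refine (setLIntegral_mono' measurableSet_closedBall hpt).trans ?_
      rw [lintegral_const_mul' _ _ (ENNReal.mul_ne_top (by simp) (by simp))]
      have h5 := hC x (t / x) hx.1 (div_ne_zero ht hx.1)
        (hx.2.1.trans (by linarith)) (hx.2.2.trans (by linarith))
      calc _ ≤ 729 * (1 + ‖t / x ^ 2‖ₑ ^ 2) *
            (C * ENNReal.ofReal (max (‖x‖ ^ p) (‖t / x‖ ^ q) ^ (-2 * c))) := by gcongr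
        _ = _ := by
          simp only [hM]
          ring
    · rw [indicator_of_notMem hx]
      refine le_of_eq ((setLIntegral_congr_fun measurableSet_closedBall fun w hw => ?_).trans
        (lintegral_zero))
      have : x * Complex.exp w ∉ Z := by
        intro h
        have hx0 : x ≠ 0 := left_ne_zero_of_mul h.1
        refine hx ⟨hx0, ?_⟩
        have h1 : ‖x * Complex.exp w‖ < ε := h.2.1
        have h2 : ‖t / (x * Complex.exp w)‖ < ε := h.2.2
        have h3 : x = x * Complex.exp w * Complex.exp (-w) := by
          rw [mul_assoc, ← Complex.exp_add]; simp
        have h4 : t / x = t / (x * Complex.exp w) * Complex.exp w := by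
          field_simp [Complex.exp_ne_zero]
        constructor
        · change ‖x‖ < 3 * ε
          rw [h3, norm_mul]
          nlinarith [(hexp w hw).2, norm_nonneg (x * Complex.exp w)]
        · change ‖t / x‖ < 3 * ε
          rw [h4, norm_mul]
          nlinarith [(hexp w hw).1, norm_nonneg (t / (x * Complex.exp w))]
      rw [indicator_of_notMem this, mul_zero]
  -- The term `1` of the density is paired with `|x|^p`, and the term `|t / x²|²` with `|t / x|^q`.
  have hMint : ∫⁻ x in Z', M x ≤ I ε := by
    have ht' : 0 < ‖t‖ := norm_pos_iff.2 ht
    have hpt : ∀ x ∈ Z', M x ≤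
        (Metric.ball (0 : ℂ) (3 * ε)).indicator (fun x => ENNReal.ofReal (‖x‖ ^ (-2 * c * p))) x +
        ENNReal.ofReal (‖t‖ ^ (-2 * c * q + 2)) * (Metric.closedBall (0 : ℂ) (‖t‖ / (3 * ε)))ᶜ.indicator
          (fun x => ENNReal.ofReal (‖x‖ ^ (2 * c * q - 4))) x := by
      intro x hx
      have hx0 : 0 < ‖x‖ := norm_pos_iff.2 hx.1
      have hx1 : x ∈ Metric.ball (0 : ℂ) (3 * ε) := mem_ball_zero_iff.2 hx.2.1
      have hx2 : x ∈ (Metric.closedBall (0 : ℂ) (‖t‖ / (3 * ε)))ᶜ := by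
        have h1 : ‖t / x‖ < 3 * ε := hx.2.2
        rw [norm_div, div_lt_iff₀ hx0] at h1
        rw [mem_compl_iff, mem_closedBall_zero_iff, not_le, div_lt_iff₀ (by positivity)]
        linarith
      rw [indicator_of_mem hx1, indicator_of_mem hx2]
      simp only [hM]
      have hneg : -2 * c ≤ 0 := by linarith
      have hy0 : 0 < ‖t / x‖ := norm_pos_iff.2 (div_ne_zero ht hx.1)
      rw [mul_add, mul_one]
      refine add_le_add (ENNReal.ofReal_le_ofReal ?_) ?_
      · refine (Real.rpow_le_rpow_of_nonpos (by positivity) (le_max_left _ _) hneg).trans (le_of_eq ?_)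
        rw [← Real.rpow_natCast, ← Real.rpow_mul hx0.le, mul_comm]
      · rw [← ofReal_norm, ← ENNReal.ofReal_pow (norm_nonneg _),
          ← ENNReal.ofReal_mul (by positivity), ← ENNReal.ofReal_mul (by positivity)]
        refine ENNReal.ofReal_le_ofReal ?_
        calc _ ≤ (‖t / x‖ ^ q) ^ (-2 * c) * ‖t / x ^ 2‖ ^ 2 := by
              gcongr ?_ * _
              exact Real.rpow_le_rpow_of_nonpos (by positivity) (le_max_right _ _) hneg
          _ = _ := by
              rw [← Real.rpow_natCast, ← Real.rpow_mul hy0.le, norm_div, norm_div, norm_pow,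
                Real.div_rpow ht'.le hx0.le, div_pow, Real.rpow_add ht',
                show (2 * c * q - 4 : ℝ) = -(q * (-2 * c)) - 4 by ring, Real.rpow_sub hx0,
                Real.rpow_neg hx0.le, mul_comm (-2 * c)]
              have e4 : ‖x‖ ^ (4 : ℝ) = ‖x‖ ^ 4 := by exact_mod_cast Real.rpow_natCast ‖x‖ 4
              have e2 : ‖t‖ ^ (2 : ℝ) = ‖t‖ ^ 2 := by exact_mod_cast Real.rpow_natCast ‖t‖ 2
              rw [e4, e2]
              have := Real.rpow_pos_of_pos hx0 (q * (-2 * c))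
              field_simp
    refine (setLIntegral_mono' (hmeas (3 * ε)) hpt).trans ((setLIntegral_le_lintegral _ _).trans ?_)
    rw [lintegral_add_left, lintegral_indicator measurableSet_ball,
      lintegral_const_mul' _ _ ENNReal.ofReal_ne_top,
      lintegral_indicator measurableSet_closedBall.compl,
      lintegral_ball_norm_rpow (by linarith) (by positivity),
      lintegral_compl_closedBall_norm_rpow (by linarith) (by positivity),
      ← ENNReal.ofReal_mul (by positivity)]
    · refine add_le_add le_rfl (ENNReal.ofReal_le_ofReal (le_of_eq ?_))
      rw [show (2 * c * q - 4 + 2 : ℝ) = -(-2 * c * q + 2) by ring,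
        Real.rpow_neg (by positivity), Real.div_rpow ht'.le (by positivity), inv_div]
      have := Real.rpow_pos_of_pos ht' (-2 * c * q + 2)
      field_simp
    · exact Measurable.indicator (by fun_prop) measurableSet_ball
  have havg := volume_mul_lintegral_eq r (hfm.indicator (hmeas ε))
  rw [lintegral_indicator (hmeas ε)] at havg
  have hle : V * ∫⁻ x in Z, f x ≤ 729 * C * I ε := by
    rw [hV, havg]
    refine (lintegral_mono horbit).trans ?_
    rw [lintegral_indicator (hmeas (3 * ε)),
      lintegral_const_mul' _ _ (ENNReal.mul_ne_top (by simp) ENNReal.coe_ne_top)]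
    gcongr
  calc ∫⁻ x in Z, f x = V⁻¹ * (V * ∫⁻ x in Z, f x) := by
        rw [← mul_assoc, ENNReal.inv_mul_cancel hV0 hVtop, one_mul]
    _ ≤ _ := mul_le_mul' le_rfl hle

/-! ### Integrals along the axes -/

/-- The half-open annulus `ε ≤ |x| < R`. -/
def annulus (ε R : ℝ) : Set ℂ := {x | ε ≤ ‖x‖ ∧ ‖x‖ < R}

theorem measurableSet_annulus (ε R : ℝ) : MeasurableSet (annulus ε R) :=
  (measurableSet_le measurable_const measurable_norm).inter
    (measurableSet_lt measurable_norm measurable_const)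

namespace LeadingPart

variable {F : ℂ × ℂ → ℂ} {p q : ℕ}

theorem exists_lintegral_axis_le (L : LeadingPart F p q) {c : ℝ} (hc : 0 < c) (hpc : p * c < 1) :
    ∃ B : ℝ → ℝ≥0∞, Tendsto B (𝓝[>] 0) (𝓝 0) ∧ (∀ ε, B ε ≠ ∞) ∧ ∃ ε₀ > 0,
      (∀ x, x ≠ 0 → ‖x‖ < ε₀ → F (x, 0) ≠ 0) ∧ ∀ ε, 0 < ε → ε < ε₀ →
      ∫⁻ x in Metric.ball (0 : ℂ) ε, ‖F (x, 0)‖ₑ ^ (-2 * c) ≤ B ε := by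
  obtain ⟨ρ, hρ, A, hA, B, -, h⟩ := L.exists_norm_axis_bounds
  have hp2 : 0 < -2 * c * p + 2 := by nlinarith
  have hlow : ∀ x, x ≠ 0 → ‖x‖ < ρ → 0 < ‖F (x, 0)‖ := fun x hx hxρ =>
    lt_of_lt_of_le (mul_pos hA (pow_pos (norm_pos_iff.2 hx) p)) (h x hxρ).1
  refine ⟨fun ε => ENNReal.ofReal (A ^ (-2 * c)) *
    ENNReal.ofReal (2 * Real.pi * (ε ^ (-2 * c * p + 2) / (-2 * c * p + 2))), ?_,
    fun ε => ENNReal.mul_ne_top ENNReal.ofReal_ne_top ENNReal.ofReal_ne_top, ρ, hρ,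
    fun x hx hxρ => norm_pos_iff.1 (hlow x hx hxρ), fun ε hε hερ => ?_⟩
  · have h2 : Continuous fun ε : ℝ =>
        ENNReal.ofReal (2 * Real.pi * (ε ^ (-2 * c * p + 2) / (-2 * c * p + 2))) := by
      refine ENNReal.continuous_ofReal.comp (continuous_const.mul (Continuous.div_const ?_ _))
      exact Real.continuous_rpow_const hp2.le
    have h3 := h2.tendsto 0
    simp only [Real.zero_rpow hp2.ne', zero_div, mul_zero, ENNReal.ofReal_zero] at h3
    have h4 := ENNReal.Tendsto.const_mul (a := ENNReal.ofReal (A ^ (-2 * c)))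
      (h3.mono_left (nhdsWithin_le_nhds (s := Ioi 0))) (Or.inr ENNReal.ofReal_ne_top)
    rwa [mul_zero] at h4
  · change _ ≤ ENNReal.ofReal _ * ENNReal.ofReal _
    rw [← lintegral_ball_norm_rpow (by linarith) hε, ← lintegral_const_mul' _ _ ENNReal.ofReal_ne_top]
    refine lintegral_mono_ae ?_
    filter_upwards [ae_restrict_mem measurableSet_ball,
      ae_restrict_of_ae (compl_mem_ae_iff.2 (measure_singleton (μ := volume) (0 : ℂ)))] with x hx hx0
    have hx' : ‖x‖ < ρ := (mem_ball_zero_iff.1 hx).trans hερ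
    have hx1 : 0 < ‖x‖ := norm_pos_iff.2 hx0
    rw [enorm_rpow_eq_ofReal (norm_pos_iff.1 (hlow x hx0 hx')), ← ENNReal.ofReal_mul (by positivity)]
    refine ENNReal.ofReal_le_ofReal ?_
    calc _ ≤ (A * ‖x‖ ^ p) ^ (-2 * c) :=
          Real.rpow_le_rpow_of_nonpos (by positivity) (h x hx').1 (by linarith)
      _ = _ := by
          rw [Real.mul_rpow hA.le (by positivity), ← Real.rpow_natCast, ← Real.rpow_mul hx1.le,
            mul_comm (p : ℝ)]

theorem mul_lt_one_of_lintegral_axis_lt_top (L : LeadingPart F p q) {c : ℝ} (hc : 0 < c)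
    {ε : ℝ} (hε : 0 < ε)
    (hfin : ∫⁻ x in Metric.ball (0 : ℂ) ε, ‖F (x, 0)‖ₑ ^ (-2 * c) < ∞) : p * c < 1 := by
  obtain ⟨ρ, hρ, A, hA, B, hB, h⟩ := L.exists_norm_axis_bounds
  by_contra! hpc
  have h1 : ∫⁻ x in Metric.ball (0 : ℂ) (min ε ρ), ENNReal.ofReal (B ^ (-2 * c)) *
      ENNReal.ofReal (‖x‖ ^ (-2 * c * p)) ≤
      ∫⁻ x in Metric.ball (0 : ℂ) ε, ‖F (x, 0)‖ₑ ^ (-2 * c) := by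
    refine le_trans (lintegral_mono_ae ?_)
      (lintegral_mono_set (Metric.ball_subset_ball (min_le_left ε ρ)))
    filter_upwards [ae_restrict_mem measurableSet_ball,
      ae_restrict_of_ae (compl_mem_ae_iff.2 (measure_singleton (μ := volume) (0 : ℂ)))] with x hx hx0
    have hx' : ‖x‖ < ρ := (mem_ball_zero_iff.1 hx).trans_le (min_le_right _ _)
    have hx1 : 0 < ‖x‖ := norm_pos_iff.2 hx0
    have hF : 0 < ‖F (x, 0)‖ := lt_of_lt_of_le (by positivity) (h x hx').1
    rw [enorm_rpow_eq_ofReal (norm_pos_iff.1 hF), ← ENNReal.ofReal_mul (by positivity)]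
    refine ENNReal.ofReal_le_ofReal ?_
    calc _ = (B * ‖x‖ ^ p) ^ (-2 * c) := by
          rw [Real.mul_rpow hB.le (by positivity), ← Real.rpow_natCast, ← Real.rpow_mul hx1.le,
            mul_comm (p : ℝ)]
      _ ≤ _ := Real.rpow_le_rpow_of_nonpos hF (h x hx').2 (by linarith)
  rw [lintegral_const_mul' _ _ ENNReal.ofReal_ne_top,
    lintegral_ball_norm_rpow_eq_top (by nlinarith) (by positivity), ENNReal.mul_top] at h1
  · exact absurd (lt_of_le_of_lt h1 hfin) (lt_irrefl _)
  · exact (ENNReal.ofReal_pos.2 (Real.rpow_pos_of_pos hB _)).ne'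

end LeadingPart

/-! ### Convergence of the integrals over the fibres -/

section

variable {F : ℂ × ℂ → ℂ} {R₀ R ε c : ℝ}

/-- Away from the origin, the fibre over `t` converges to the `x`-axis and `F` has no zeros. -/
theorem tendsto_lintegral_annulus (hF : ContinuousOn F (polydisc R₀)) (hFm : Measurable F)
    (hc : 0 < c) (hε : 0 < ε) (hεR : ε ≤ R) (hR : R < R₀)
    (hF0 : ∀ x, x ≠ 0 → ‖x‖ ≤ R → F (x, 0) ≠ 0) :
    (∫⁻ x in annulus ε R, ‖F (x, 0)‖ₑ ^ (-2 * c)) ≠ ∞ ∧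
    Tendsto (fun t : ℂ => ∫⁻ x in annulus ε R,
      ‖F (x, t / x)‖ₑ ^ (-2 * c) * (1 + ‖t / x ^ 2‖ₑ ^ 2)) (𝓝 0)
      (𝓝 (∫⁻ x in annulus ε R, ‖F (x, 0)‖ₑ ^ (-2 * c))) := by
  set K : Set ℂ := Metric.closedBall 0 R ∩ {x | ε ≤ ‖x‖} with hK
  have hKc : IsCompact K := (isCompact_closedBall 0 R).inter_right
    (isClosed_le continuous_const continuous_norm)
  have hK0 : ∀ x ∈ K, x ≠ 0 := fun x hx => norm_pos_iff.1 (hε.trans_le hx.2)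
  have hKR : ∀ x ∈ K, ‖x‖ ≤ R := fun x hx => mem_closedBall_zero_iff.1 hx.1
  have hsub : annulus ε R ⊆ K := fun x hx => ⟨mem_closedBall_zero_iff.2 hx.2.le, hx.1⟩
  have hcont : ∀ x ∈ K, ContinuousAt (fun z : ℂ × ℂ => F (z.2, z.1 / z.2)) (0, x) := by
    intro x hx
    have h1 : ((x, 0 / x) : ℂ × ℂ) ∈ polydisc R₀ := by
      rw [zero_div]
      exact ⟨(hKR x hx).trans_lt hR, by simpa using (hε.trans_le hεR).trans hR⟩
    have h2 : ContinuousAt (fun z : ℂ × ℂ => (z.2, z.1 / z.2)) (0, x) :=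
      continuousAt_snd.prodMk (continuousAt_fst.div₀ continuousAt_snd (hK0 x hx))
    exact ContinuousAt.comp (f := fun z : ℂ × ℂ => (z.2, z.1 / z.2)) (g := F) (x := ((0, x) : ℂ × ℂ))
      (hF.continuousAt ((isOpen_polydisc R₀).mem_nhds h1)) h2
  have hcont2 : ∀ x ∈ K, ContinuousAt (fun z : ℂ × ℂ => z.1 / z.2 ^ 2) (0, x) := fun x hx =>
    continuousAt_fst.div₀ (continuousAt_snd.pow 2) (pow_ne_zero 2 (hK0 x hx))
  obtain ⟨m, hm, hmK⟩ : ∃ m > 0, ∀ x ∈ K, m < ‖F (x, 0)‖ := by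
    have hcx : ContinuousOn (fun x => ‖F (x, 0)‖) K := by
      refine (hF.comp (f := fun x : ℂ => (x, (0 : ℂ))) (by fun_prop) fun x hx => ?_).norm
      exact ⟨(hKR x hx).trans_lt hR, by simpa using (hε.trans_le hεR).trans hR⟩
    obtain ⟨x₀, hx₀, hmin⟩ := hKc.exists_isMinOn ⟨(ε : ℂ), by
      constructor
      · rw [mem_closedBall_zero_iff, Complex.norm_real, Real.norm_of_nonneg hε.le]; exact hεR
      · change ε ≤ ‖(ε : ℂ)‖
        rw [Complex.norm_real, Real.norm_of_nonneg hε.le]⟩ hcx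
    have h0 : 0 < ‖F (x₀, 0)‖ := norm_pos_iff.2 (hF0 x₀ (hK0 x₀ hx₀) (hKR x₀ hx₀))
    exact ⟨‖F (x₀, 0)‖ / 2, by positivity, fun x hx => by
      have : ‖F (x₀, 0)‖ ≤ ‖F (x, 0)‖ := hmin hx
      linarith⟩
  have hev : ∀ᶠ t : ℂ in 𝓝 0, ∀ x ∈ K, m < ‖F (x, t / x)‖ ∧ ‖t / x ^ 2‖ < 1 := by
    refine hKc.eventually_forall_of_forall_eventually fun x hx => ?_
    have h1 := (hcont x hx).norm
    have h2 := (hcont2 x hx).norm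
    refine (h1.eventually (lt_mem_nhds ?_)).and (h2.eventually (gt_mem_nhds ?_))
    · simpa using hmK x hx
    · simp
  have hbound : ∀ᶠ t : ℂ in 𝓝 0, ∀ x ∈ K,
      ‖F (x, t / x)‖ₑ ^ (-2 * c) * (1 + ‖t / x ^ 2‖ₑ ^ 2) ≤ ENNReal.ofReal (m ^ (-2 * c)) * 2 := by
    filter_upwards [hev] with t ht x hx
    obtain ⟨h1, h2⟩ := ht x hx
    refine mul_le_mul' ?_ ?_
    · rw [enorm_rpow_eq_ofReal (norm_pos_iff.1 (hm.trans h1))]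
      exact ENNReal.ofReal_le_ofReal (Real.rpow_le_rpow_of_nonpos hm h1.le (by linarith))
    · have h3 : ‖t / x ^ 2‖ₑ ≤ 1 := by
        rw [← ofReal_norm]
        exact ENNReal.ofReal_le_one.2 h2.le
      exact (add_le_add le_rfl (pow_le_one₀ zero_le h3)).trans_eq one_add_one_eq_two
  have hfin : ∫⁻ _ in annulus ε R, ENNReal.ofReal (m ^ (-2 * c)) * 2 ≠ ∞ := by
    rw [setLIntegral_const]
    exact ENNReal.mul_ne_top (ENNReal.mul_ne_top ENNReal.ofReal_ne_top (by simp))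
      ((measure_mono hsub).trans_lt hKc.measure_lt_top).ne
  constructor
  · refine ne_top_of_le_ne_top hfin (setLIntegral_mono' (measurableSet_annulus ε R) fun x hx => ?_)
    simpa using hbound.self_of_nhds x (hsub hx)
  · refine tendsto_lintegral_filter_of_dominated_convergence
      (fun _ => ENNReal.ofReal (m ^ (-2 * c)) * 2) (Eventually.of_forall fun t => ?_) ?_ hfin ?_
    · have h1 : Measurable fun x : ℂ => F (x, t / x) :=
        hFm.comp (measurable_id.prodMk (measurable_const.div measurable_id))
      have h2 : Measurable fun x : ℂ => t / x ^ 2 :=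
        measurable_const.div (measurable_id.pow_const 2)
      fun_prop
    · filter_upwards [hbound] with t ht
      filter_upwards [ae_restrict_mem (measurableSet_annulus ε R)] with x hx
      exact ht x (hsub hx)
    · filter_upwards [ae_restrict_mem (measurableSet_annulus ε R)] with x hx
      have hpair : Tendsto (fun t : ℂ => (t, x)) (𝓝 0) (𝓝 (0, x)) :=
        (Continuous.prodMk_left x).tendsto 0
      have h1 : Tendsto (fun t => F (x, t / x)) (𝓝 0) (𝓝 (F (x, 0))) := by
        have := (hcont x (hsub hx)).tendsto.comp hpair
        simpa [Function.comp_def] using this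
      have h2 : Tendsto (fun t => t / x ^ 2) (𝓝 0) (𝓝 0) := by
        have := (hcont2 x (hsub hx)).tendsto.comp hpair
        simpa [Function.comp_def] using this
      have h3 : Tendsto (fun t => ‖F (x, t / x)‖ₑ ^ (-2 * c)) (𝓝 0) (𝓝 (‖F (x, 0)‖ₑ ^ (-2 * c))) :=
        (ENNReal.continuous_rpow_const.tendsto _).comp h1.enorm
      have h4 : Tendsto (fun t => 1 + ‖t / x ^ 2‖ₑ ^ 2) (𝓝 0) (𝓝 1) := by
        have := (ENNReal.Tendsto.pow (n := 2) h2.enorm).const_add 1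
        simpa using this
      have h5 := ENNReal.Tendsto.mul h3 (Or.inr ENNReal.one_ne_top) h4 (Or.inl one_ne_zero)
      rwa [mul_one] at h5

/-- The part of a fibre in a polydisc is cut into the part near the `x`-axis, the part near the
`y`-axis and the part near the origin. -/
theorem singularIntegral_fiber_eq_add {t : ℂ} (ht : t ≠ 0) (hε : 0 < ε) (hεR : ε ≤ R)
    (hR : R ≤ R₀) (htε : ‖t‖ < ε ^ 2) :
    singularIntegral (fiber R₀ t) F c (polydisc R) =
      (∫⁻ x in annulus ε R, ‖F (x, t / x)‖ₑ ^ (-2 * c) * (1 + ‖t / x ^ 2‖ₑ ^ 2)) +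
      ((∫⁻ y in annulus ε R, ‖F (t / y, y)‖ₑ ^ (-2 * c) * (1 + ‖t / y ^ 2‖ₑ ^ 2)) +
      ∫⁻ x in {x | x ≠ 0 ∧ (x, t / x) ∈ polydisc ε},
        ‖F (x, t / x)‖ₑ ^ (-2 * c) * (1 + ‖t / x ^ 2‖ₑ ^ 2)) := by
  have hB1 : MeasurableSet {q : ℂ × ℂ | ε ≤ ‖q.1‖} :=
    measurableSet_le measurable_const measurable_fst.norm
  have hB2 : MeasurableSet {q : ℂ × ℂ | ε ≤ ‖q.2‖} :=
    measurableSet_le measurable_const measurable_snd.norm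
  have hP := (isOpen_polydisc R).measurableSet
  have hsmall : ∀ x, x ∈ annulus ε R → x ≠ 0 ∧ ‖t / x‖ < ε := by
    intro x hx
    have hx0 : 0 < ‖x‖ := hε.trans_le hx.1
    refine ⟨norm_pos_iff.1 hx0, ?_⟩
    rw [norm_div, div_lt_iff₀ hx0]
    nlinarith [hx.1]
  have hsplit : singularIntegral (fiber R₀ t) F c (polydisc R) =
      singularIntegral (fiber R₀ t) F c (polydisc R ∩ {q | ε ≤ ‖q.1‖}) +
      (singularIntegral (fiber R₀ t) F c ((polydisc R \ {q | ε ≤ ‖q.1‖}) ∩ {q | ε ≤ ‖q.2‖}) +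
      singularIntegral (fiber R₀ t) F c ((polydisc R \ {q | ε ≤ ‖q.1‖}) \ {q | ε ≤ ‖q.2‖})) := by
    unfold singularIntegral
    rw [← lintegral_inter_add_sdiff (B := {q : ℂ × ℂ | ε ≤ ‖q.1‖}) _ (fiber R₀ t ∩ polydisc R) hB1,
      ← lintegral_inter_add_sdiff (B := {q : ℂ × ℂ | ε ≤ ‖q.2‖}) _
        ((fiber R₀ t ∩ polydisc R) \ _) hB2]
    simp only [inter_assoc, inter_sdiff_assoc]
  rw [hsplit, singularIntegral_fiber ht (hP.inter hB1),
    singularIntegral_fiber_swap ht ((hP.diff hB1).inter hB2),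
    singularIntegral_fiber ht ((hP.diff hB1).diff hB2)]
  have e1 : {x | x ≠ 0 ∧ (x, t / x) ∈ polydisc R₀ ∩ (polydisc R ∩ {q | ε ≤ ‖q.1‖})} =
      annulus ε R := by
    ext x
    constructor
    · exact fun h => ⟨h.2.2.2, h.2.2.1.1⟩
    · intro h
      obtain ⟨h0, h1⟩ := hsmall x h
      exact ⟨h0, ⟨h.2.trans_le hR, h1.trans_le (hεR.trans hR)⟩, ⟨h.2, h1.trans_le hεR⟩, h.1⟩
  have e2 : {y | y ≠ 0 ∧ (t / y, y) ∈ polydisc R₀ ∩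
      ((polydisc R \ {q | ε ≤ ‖q.1‖}) ∩ {q | ε ≤ ‖q.2‖})} = annulus ε R := by
    ext x
    constructor
    · exact fun h => ⟨h.2.2.2, h.2.2.1.1.2⟩
    · intro h
      obtain ⟨h0, h1⟩ := hsmall x h
      exact ⟨h0, ⟨h1.trans_le (hεR.trans hR), h.2.trans_le hR⟩,
        ⟨⟨h1.trans_le hεR, h.2⟩, not_le.2 h1⟩, h.1⟩
  have e3 : {x | x ≠ 0 ∧ (x, t / x) ∈ polydisc R₀ ∩
      ((polydisc R \ {q | ε ≤ ‖q.1‖}) \ {q | ε ≤ ‖q.2‖})} =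
      {x | x ≠ 0 ∧ (x, t / x) ∈ polydisc ε} := by
    ext x
    constructor
    · exact fun h => ⟨h.1, not_le.1 h.2.2.1.2, not_le.1 h.2.2.2⟩
    · exact fun h => ⟨h.1, ⟨h.2.1.trans_le (hεR.trans hR), h.2.2.trans_le (hεR.trans hR)⟩,
        ⟨⟨h.2.1.trans_le hεR, h.2.2.trans_le hεR⟩, not_le.2 h.2.1⟩, not_le.2 h.2.2⟩
  rw [e1, e2, e3]

theorem lintegral_ball_eq_add (f : ℂ → ℝ≥0∞) (hεR : ε ≤ R) :
    ∫⁻ x in Metric.ball (0 : ℂ) R, f x =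
      (∫⁻ x in annulus ε R, f x) + ∫⁻ x in Metric.ball (0 : ℂ) ε, f x := by
  rw [← lintegral_inter_add_sdiff (B := Metric.ball (0 : ℂ) ε) _ _ measurableSet_ball, add_comm,
    inter_eq_right.2 (Metric.ball_subset_ball hεR)]
  congr 3
  ext x
  simp [annulus, and_comm]

theorem singularIntegral_fiber_zero_polydisc (hR0 : 0 < R) (hR : R ≤ R₀) :
    singularIntegral (fiber R₀ 0) F c (polydisc R) =
      (∫⁻ x in Metric.ball (0 : ℂ) R, ‖F (x, 0)‖ₑ ^ (-2 * c)) +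
      ∫⁻ y in Metric.ball (0 : ℂ) R, ‖F (0, y)‖ₑ ^ (-2 * c) := by
  rw [singularIntegral_fiber_zero (isOpen_polydisc R).measurableSet]
  have hae : ∀ f : ℂ → ℝ≥0∞, ∫⁻ x in Metric.ball (0 : ℂ) R \ {0}, f x =
      ∫⁻ x in Metric.ball (0 : ℂ) R, f x := fun f =>
    setLIntegral_congr (sdiff_null_ae_eq_self (measure_singleton 0))
  rw [← hae, ← hae]
  congr 3
  · ext x
    simp only [polydisc, mem_ofPred_eq, mem_inter_iff, norm_zero, Set.mem_sdiff,
      mem_ball_zero_iff, mem_singleton_iff]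
    constructor
    · exact fun h => ⟨h.2.2.1, h.1⟩
    · exact fun h => ⟨h.2, ⟨h.1.trans_le hR, hR0.trans_le hR⟩, h.1, hR0⟩
  · ext x
    simp only [polydisc, mem_ofPred_eq, mem_inter_iff, norm_zero, Set.mem_sdiff,
      mem_ball_zero_iff, mem_singleton_iff]
    constructor
    · exact fun h => ⟨h.2.2.2, h.1⟩
    · exact fun h => ⟨h.2, ⟨hR0.trans_le hR, h.1.trans_le hR⟩, hR0, h.1⟩

/-- The convergence of the integrals for a measurable function with a leading part: the parts of the
fibres outside a polydisc of radius `ε` converge, and the parts inside it are uniformly small. -/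
theorem exists_tendsto_singularIntegral {p q : ℕ} (L : LeadingPart F p q) (hR₀ : 0 < R₀)
    (hF : DifferentiableOn ℂ F (polydisc R₀)) (hFm : Measurable F) (hc : 0 < c) (hpc : p * c < 1)
    (hqc : q * c < 1) :
    ∃ R : ℝ, 0 < R ∧ R ≤ R₀ ∧ singularIntegral (fiber R₀ 0) F c (polydisc R) < ∞ ∧
      Tendsto (fun t : ℂ => singularIntegral (fiber R₀ t) F c (polydisc R)) (𝓝[≠] 0)
        (𝓝 (singularIntegral (fiber R₀ 0) F c (polydisc R))) := by
  obtain ⟨B, hB, εB, hεB, hBle⟩ := L.exists_lintegral_polydisc_le hR₀ hF hFm hc hpc hqc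
  obtain ⟨B₁, hB₁, hB₁top, ε₁, hε₁, hne₁, hB₁le⟩ := L.exists_lintegral_axis_le hc hpc
  obtain ⟨B₂, hB₂, hB₂top, ε₂, hε₂, hne₂, hB₂le⟩ := L.swap.exists_lintegral_axis_le hc hqc
  simp only [Prod.swap_prod_mk] at hne₂ hB₂le
  set R := min (R₀ / 2) (min (ε₁ / 2) (ε₂ / 2)) with hRdef
  have hR : 0 < R := by positivity
  have hRR₀ : R < R₀ := (min_le_left _ _).trans_lt (by linarith)
  have hRε₁ : R < ε₁ := ((min_le_right _ _).trans (min_le_left _ _)).trans_lt (by linarith)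
  have hRε₂ : R < ε₂ := ((min_le_right _ _).trans (min_le_right _ _)).trans_lt (by linarith)
  have hI₀ := singularIntegral_fiber_zero_polydisc (F := F) (c := c) hR hRR₀.le
  have hfin : singularIntegral (fiber R₀ 0) F c (polydisc R) < ∞ := by
    rw [hI₀]
    exact ENNReal.add_lt_top.2 ⟨(hB₁le R hR hRε₁).trans_lt (hB₁top R).lt_top,
      (hB₂le R hR hRε₂).trans_lt (hB₂top R).lt_top⟩
  refine ⟨R, hR, hRR₀.le, hfin, (ENNReal.tendsto_nhds hfin.ne).2 fun τ hτ => ?_⟩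
  have hτ4 : 0 < τ / 4 := ENNReal.div_pos hτ.ne' (by simp)
  have hsum : τ / 4 + τ / 4 + (τ / 4 + τ / 4) = τ := by
    rw [← two_mul, ← two_mul, ← mul_assoc]
    norm_num
    exact ENNReal.mul_div_cancel (by simp) (by simp)
  obtain ⟨ε, ⟨⟨hBε, hB₁ε⟩, hB₂ε⟩, hε, hεm⟩ :=
    (((hB.eventually (gt_mem_nhds hτ4)).and (hB₁.eventually (gt_mem_nhds hτ4))).and
      (hB₂.eventually (gt_mem_nhds hτ4))).and (Ioo_mem_nhdsGT (lt_min hεB hR)) |>.exists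
  have hεR : ε ≤ R := (hεm.trans_le (min_le_right _ _)).le
  have hεεB : ε < εB := hεm.trans_le (min_le_left _ _)
  have hFs : DifferentiableOn ℂ (fun z : ℂ × ℂ => F z.swap) (polydisc R₀) :=
    hF.comp (differentiable_snd.prodMk differentiable_fst).differentiableOn
      fun z hz => swap_mem_polydisc.2 hz
  obtain ⟨hfin₁, hlim₁⟩ := tendsto_lintegral_annulus hF.continuousOn hFm hc hε hεR hRR₀
    fun x hx hxR => hne₁ x hx (hxR.trans_lt hRε₁)
  obtain ⟨hfin₂, hlim₂⟩ := tendsto_lintegral_annulus hFs.continuousOn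
    (hFm.comp measurable_swap) hc hε hεR hRR₀
    fun x hx hxR => hne₂ x hx (hxR.trans_lt hRε₂)
  simp only [Prod.swap_prod_mk] at hfin₂ hlim₂
  have hev₁ := (ENNReal.tendsto_nhds hfin₁).1 hlim₁ (τ / 4) hτ4
  have hev₂ := (ENNReal.tendsto_nhds hfin₂).1 hlim₂ (τ / 4) hτ4
  have hevt : ∀ᶠ t : ℂ in 𝓝 0, ‖t‖ < ε ^ 2 := by
    have := (continuous_norm (E := ℂ)).tendsto 0
    rw [norm_zero] at this
    exact this.eventually (gt_mem_nhds (by positivity))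
  filter_upwards [nhdsWithin_le_nhds hev₁, nhdsWithin_le_nhds hev₂, nhdsWithin_le_nhds hevt,
    self_mem_nhdsWithin] with t ht₁ ht₂ htε ht0
  rw [hI₀, singularIntegral_fiber_eq_add ht0 hε hεR hRR₀.le htε,
    lintegral_ball_eq_add _ hεR,
    lintegral_ball_eq_add (fun y => ‖F (0, y)‖ₑ ^ (-2 * c)) hεR]
  have hm := (hBle ε hε hεεB t ht0).trans hBε.le
  have hb₁ := (hB₁le ε hε (hεR.trans_lt hRε₁)).trans hB₁ε.le
  have hb₂ := (hB₂le ε hε (hεR.trans_lt hRε₂)).trans hB₂ε.le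
  constructor
  · rw [tsub_le_iff_right]
    calc _ ≤ ((∫⁻ x in annulus ε R, ‖F (x, t / x)‖ₑ ^ (-2 * c) * (1 + ‖t / x ^ 2‖ₑ ^ 2)) +
          τ / 4 + τ / 4) +
          ((∫⁻ y in annulus ε R, ‖F (t / y, y)‖ₑ ^ (-2 * c) * (1 + ‖t / y ^ 2‖ₑ ^ 2)) +
          τ / 4 + τ / 4) :=
          add_le_add (add_le_add (tsub_le_iff_right.1 ht₁.1) hb₁)
            (add_le_add (tsub_le_iff_right.1 ht₂.1) hb₂)
      _ = (∫⁻ x in annulus ε R, ‖F (x, t / x)‖ₑ ^ (-2 * c) * (1 + ‖t / x ^ 2‖ₑ ^ 2)) +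
          ((∫⁻ y in annulus ε R, ‖F (t / y, y)‖ₑ ^ (-2 * c) * (1 + ‖t / y ^ 2‖ₑ ^ 2)) + 0) +
          (τ / 4 + τ / 4 + (τ / 4 + τ / 4)) := by ring
      _ ≤ _ := by
        rw [hsum]
        gcongr
        exact zero_le
  · calc _ ≤ ((∫⁻ x in annulus ε R, ‖F (x, 0)‖ₑ ^ (-2 * c)) + τ / 4) +
          (((∫⁻ y in annulus ε R, ‖F (0, y)‖ₑ ^ (-2 * c)) + τ / 4) + τ / 4) :=
          add_le_add ht₁.2 (add_le_add ht₂.2 hm)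
      _ = ((∫⁻ x in annulus ε R, ‖F (x, 0)‖ₑ ^ (-2 * c)) + 0) +
          ((∫⁻ y in annulus ε R, ‖F (0, y)‖ₑ ^ (-2 * c)) + 0) +
          (τ / 4 + τ / 4 + (τ / 4 + 0)) := by ring
      _ ≤ ((∫⁻ x in annulus ε R, ‖F (x, 0)‖ₑ ^ (-2 * c)) +
            ∫⁻ x in Metric.ball (0 : ℂ) ε, ‖F (x, 0)‖ₑ ^ (-2 * c)) +
          ((∫⁻ y in annulus ε R, ‖F (0, y)‖ₑ ^ (-2 * c)) +
            ∫⁻ y in Metric.ball (0 : ℂ) ε, ‖F (0, y)‖ₑ ^ (-2 * c)) +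
          (τ / 4 + τ / 4 + (τ / 4 + τ / 4)) := by gcongr <;> exact zero_le
      _ = _ := by rw [hsum]

end

/-! ### The orders of vanishing along the axes -/

/-- If `|F(x, 0)|^{-2c}` is integrable near the origin, then the power series of `F` has a term that
is a power of `x`. -/
theorem exists_coeff_ne_zero {F : ℂ × ℂ → ℂ} {a : ℕ × ℕ → ℂ}
    (hF : ∀ᶠ q : ℂ × ℂ in 𝓝 0, HasSum (fun n : ℕ × ℕ => a n * (q.1 ^ n.1 * q.2 ^ n.2)) (F q))
    {c ε : ℝ} (hc : 0 < c) (hε : 0 < ε)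
    (hfin : ∫⁻ x in Metric.ball (0 : ℂ) ε, ‖F (x, 0)‖ₑ ^ (-2 * c) < ∞) : ∃ k, a (k, 0) ≠ 0 := by
  by_contra! h
  obtain ⟨ρ, hρ, hball⟩ := Metric.eventually_nhds_iff.1 hF
  have hzero : ∀ x ∈ Metric.ball (0 : ℂ) (min ε ρ), ‖F (x, 0)‖ₑ ^ (-2 * c) = ∞ := by
    intro x hx
    have hx' : ‖x‖ < ρ := (mem_ball_zero_iff.1 hx).trans_le (min_le_right _ _)
    have h1 := hball (y := (x, 0)) (by
      rw [dist_zero_right, Prod.norm_def]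
      simpa [hρ] using hx')
    have h2 : (fun n : ℕ × ℕ => a n * (x ^ n.1 * (0 : ℂ) ^ n.2)) = fun _ => 0 := by
      funext ⟨n, m⟩
      rcases Nat.eq_zero_or_pos m with rfl | hm
      · simp [h n]
      · simp [hm.ne']
    have h3 : F (x, 0) = 0 := HasSum.unique (h2 ▸ h1) hasSum_zero
    rw [h3, enorm_zero, ENNReal.zero_rpow_of_neg (by linarith)]
  have h4 : ∫⁻ x in Metric.ball (0 : ℂ) (min ε ρ), ‖F (x, 0)‖ₑ ^ (-2 * c) = ∞ := by
    rw [setLIntegral_congr_fun measurableSet_ball hzero, setLIntegral_const,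
      ENNReal.top_mul (Metric.measure_ball_pos volume 0 (by positivity)).ne']
  refine absurd (lt_of_le_of_lt ?_ hfin) (lt_irrefl _)
  rw [← h4]
  exact lintegral_mono_set (Metric.ball_subset_ball (min_le_left _ _))

/-- The order of vanishing along the `x`-axis. -/
theorem exists_order {F : ℂ × ℂ → ℂ} {a : ℕ × ℕ → ℂ}
    (hF : ∀ᶠ q : ℂ × ℂ in 𝓝 0, HasSum (fun n : ℕ × ℕ => a n * (q.1 ^ n.1 * q.2 ^ n.2)) (F q))
    {c ε : ℝ} (hc : 0 < c) (hε : 0 < ε)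
    (hfin : ∫⁻ x in Metric.ball (0 : ℂ) ε, ‖F (x, 0)‖ₑ ^ (-2 * c) < ∞) :
    ∃ p, a (p, 0) ≠ 0 ∧ ∀ k < p, a (k, 0) = 0 := by
  classical
  have h := exists_coeff_ne_zero hF hc hε hfin
  exact ⟨Nat.find h, Nat.find_spec h, fun k hk => not_not.1 (Nat.find_min h hk)⟩

/-- Exponents of monomials in two variables as pairs. -/
noncomputable def finTwoFinsuppEquiv : (Fin 2 →₀ ℕ) ≃ ℕ × ℕ :=
  Finsupp.equivFunOnFinite.trans (finTwoArrowEquiv ℕ)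

theorem IsIrreducibleGerm.exists_hasSum {F : ℂ × ℂ → ℂ} (h : IsIrreducibleGerm F) :
    ∃ a : ℕ × ℕ → ℂ, ∃ r > 0, (Summable fun n : ℕ × ℕ => ‖a n‖ * (r ^ n.1 * r ^ n.2)) ∧
      ∀ᶠ q : ℂ × ℂ in 𝓝 0, HasSum (fun n : ℕ × ℕ => a n * (q.1 ^ n.1 * q.2 ^ n.2)) (F q) := by
  obtain ⟨P, hP, -⟩ := h
  obtain ⟨r, hr, hs⟩ := P.2
  refine ⟨fun n => MvPowerSeries.coeff (finTwoFinsuppEquiv.symm n) (P : MvPowerSeries (Fin 2) ℂ),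
    r, hr, ?_, ?_⟩
  · rw [← finTwoFinsuppEquiv.summable_iff]
    refine hs.congr fun n => ?_
    simp only [Function.comp, Equiv.symm_apply_apply]
    rfl
  · filter_upwards [hP] with q hq
    rw [← finTwoFinsuppEquiv.hasSum_iff]
    have h1 : (fun n : ℕ × ℕ => MvPowerSeries.coeff (finTwoFinsuppEquiv.symm n)
        (P : MvPowerSeries (Fin 2) ℂ) * (q.1 ^ n.1 * q.2 ^ n.2)) ∘ finTwoFinsuppEquiv =
        fun n => MvPowerSeries.coeff n (P : MvPowerSeries (Fin 2) ℂ) * (q.1 ^ n 0 * q.2 ^ n 1) := by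
      funext n
      simp only [Function.comp, Equiv.symm_apply_apply]
      rfl
    rwa [h1]

theorem exists_ball_lintegral_axis_lt_top {R₀ c : ℝ} (hR₀ : 0 < R₀) {F : ℂ × ℂ → ℂ}
    {U : Set (ℂ × ℂ)} (hU : IsOpen U) (h0 : (0 : ℂ × ℂ) ∈ U)
    (h : singularIntegral (fiber R₀ 0) F c U < ∞) :
    ∃ ε > 0, ε ≤ R₀ ∧ (∫⁻ x in Metric.ball (0 : ℂ) ε, ‖F (x, 0)‖ₑ ^ (-2 * c) < ∞) ∧
      ∫⁻ y in Metric.ball (0 : ℂ) ε, ‖F (0, y)‖ₑ ^ (-2 * c) < ∞ := by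
  obtain ⟨ρ, hρ, hball⟩ := Metric.isOpen_iff.1 hU 0 h0
  have hε : 0 < min ρ R₀ := lt_min hρ hR₀
  have hsub : polydisc (min ρ R₀) ⊆ U := fun q hq => hball (by
    rw [mem_ball_zero_iff, Prod.norm_def]
    exact max_lt (hq.1.trans_le (min_le_left _ _)) (hq.2.trans_le (min_le_left _ _)))
  have h1 := singularIntegral_fiber_zero_polydisc (F := F) (c := c) hε (min_le_right ρ R₀)
  have h2 : singularIntegral (fiber R₀ 0) F c (polydisc (min ρ R₀)) < ∞ :=
    (lintegral_mono_set (inter_subset_inter_right _ hsub)).trans_lt h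
  rw [h1, ENNReal.add_lt_top] at h2
  exact ⟨_, hε, min_le_right _ _, h2.1, h2.2⟩

theorem singularIntegral_congr {R₀ R c : ℝ} {F G : ℂ × ℂ → ℂ} (h : EqOn F G (polydisc R₀)) (t : ℂ) :
    singularIntegral (fiber R₀ t) F c (polydisc R) =
      singularIntegral (fiber R₀ t) G c (polydisc R) := by
  have hm : MeasurableSet (fiber R₀ t ∩ polydisc R) := by
    refine MeasurableSet.inter ?_ (isOpen_polydisc R).measurableSet
    exact (isOpen_polydisc R₀).measurableSet.inter
      (measurableSet_eq_fun (measurable_fst.mul measurable_snd) measurable_const)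
  exact setLIntegral_congr_fun hm fun q hq => by rw [h hq.1.1]

theorem theorem1p4 (R₀ : ℝ) (hR₀ : 0 < R₀) (F : ℂ × ℂ → ℂ)
    (hF : DifferentiableOn ℂ F (polydisc R₀)) (hirr : IsIrreducibleGerm F)
    (c : ℝ) (hc : 0 < c)
    (hc₀ : ENNReal.ofReal c < complexSingularityExponent (fiber R₀ 0) F 0) :
    ∃ R : ℝ, 0 < R ∧ R ≤ R₀ ∧
      singularIntegral (fiber R₀ 0) F c (polydisc R) < ∞ ∧
      Tendsto (fun t : ℂ => singularIntegral (fiber R₀ t) F c (polydisc R)) (𝓝[≠] 0)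
        (𝓝 (singularIntegral (fiber R₀ 0) F c (polydisc R))) := by
  obtain ⟨a, r, hr, hs, hsum⟩ := hirr.exists_hasSum
  obtain ⟨c', hc'⟩ := lt_iSup_iff.1 hc₀
  obtain ⟨⟨U, hU, h0, hint⟩, hcc'⟩ := lt_iSup_iff.1 hc'
  have hlt : c < c' := by
    rw [← ENNReal.ofReal_coe_nnreal] at hcc'
    exact (ENNReal.ofReal_lt_ofReal_iff_of_nonneg hc.le).1 hcc'
  have hc'0 : (0 : ℝ) < c' := hc.trans hlt
  -- Outside the polydisc, `F` is arbitrary, and is replaced by `0` to make it measurable.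
  classical
  set G : ℂ × ℂ → ℂ := (polydisc R₀).indicator F with hG
  have hFG : EqOn F G (polydisc R₀) := fun q hq => (indicator_of_mem hq F).symm
  have hGd : DifferentiableOn ℂ G (polydisc R₀) := hF.congr fun q hq => (hFG hq).symm
  have hGm : Measurable G := by
    have : Measurable ((polydisc R₀).piecewise F 0) :=
      hF.continuousOn.measurable_piecewise continuousOn_const (isOpen_polydisc R₀).measurableSet
    rwa [piecewise_eq_indicator] at this
  have hGsum : ∀ᶠ q : ℂ × ℂ in 𝓝 0,
      HasSum (fun n : ℕ × ℕ => a n * (q.1 ^ n.1 * q.2 ^ n.2)) (G q) := by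
    have h0 : (0 : ℂ × ℂ) ∈ polydisc R₀ := ⟨by simpa using hR₀, by simpa using hR₀⟩
    filter_upwards [hsum, (isOpen_polydisc R₀).mem_nhds h0] with q hq hq'
    rwa [← hFG hq']
  obtain ⟨ε, hε, hεR₀, hx, hy⟩ := exists_ball_lintegral_axis_lt_top hR₀ hU h0 hint
  have hGx : ∫⁻ x in Metric.ball (0 : ℂ) ε, ‖G (x, 0)‖ₑ ^ (-2 * (c' : ℝ)) < ∞ := by
    rwa [← setLIntegral_congr_fun (f := fun x => ‖F (x, 0)‖ₑ ^ (-2 * (c' : ℝ))) measurableSet_ball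
      fun x hx =>
        congrArg (‖·‖ₑ ^ (-2 * (c' : ℝ)))
          (hFG ⟨(mem_ball_zero_iff.1 hx).trans_le hεR₀, by simpa using hR₀⟩)]
  have hGy : ∫⁻ y in Metric.ball (0 : ℂ) ε, ‖G (0, y)‖ₑ ^ (-2 * (c' : ℝ)) < ∞ := by
    rwa [← setLIntegral_congr_fun (f := fun y => ‖F (0, y)‖ₑ ^ (-2 * (c' : ℝ))) measurableSet_ball
      fun y hy =>
        congrArg (‖·‖ₑ ^ (-2 * (c' : ℝ)))
          (hFG ⟨by simpa using hR₀, (mem_ball_zero_iff.1 hy).trans_le hεR₀⟩)]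
  obtain ⟨p, hp, hp'⟩ := exists_order hGsum hc'0 hε hGx
  have hGsum' : ∀ᶠ q : ℂ × ℂ in 𝓝 0,
      HasSum (fun n : ℕ × ℕ => a n.swap * (q.1 ^ n.1 * q.2 ^ n.2)) (G q.swap) := by
    have h1 : Tendsto (Prod.swap : ℂ × ℂ → ℂ × ℂ) (𝓝 0) (𝓝 0) := continuous_swap.tendsto 0
    filter_upwards [h1.eventually hGsum] with q hq
    rw [← (Equiv.prodComm ℕ ℕ).hasSum_iff] at hq
    have h2 : (fun n : ℕ × ℕ => a n * (q.swap.1 ^ n.1 * q.swap.2 ^ n.2)) ∘ Equiv.prodComm ℕ ℕ =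
        fun n => a n.swap * (q.1 ^ n.1 * q.2 ^ n.2) :=
      funext fun n => congrArg (a n.swap * ·) (mul_comm _ _)
    rwa [h2] at hq
  obtain ⟨q, hq, hq'⟩ := exists_order (F := fun z => G z.swap) hGsum' hc'0 hε hGy
  obtain ⟨L⟩ := nonempty_leadingPart hr hs hGsum hp hp' hq hq'
  have hpc : p * c < 1 := (mul_le_mul_of_nonneg_left hlt.le (Nat.cast_nonneg p)).trans_lt
    (L.mul_lt_one_of_lintegral_axis_lt_top hc'0 hε hGx)
  have hqc : q * c < 1 := (mul_le_mul_of_nonneg_left hlt.le (Nat.cast_nonneg q)).trans_lt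
    (L.swap.mul_lt_one_of_lintegral_axis_lt_top hc'0 hε hGy)
  simp_rw [singularIntegral_congr hFG]
  exact exists_tendsto_singularIntegral L hR₀ hGd hGm hc hpc hqc
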